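/- Let $0<\alpha<1$. The Darling--Mandelbrot law of parameter $\alpha$ is the unique probability measure on $\mathbb R$ with characteristic function $$\phi_\alpha(s)=\Bigl(1-\sum_{n\ge1}\frac{\alpha}{n-\alpha}\,\frac{(is)^n}{n!}\Bigr)^{-1}\qquad(s\in\mathbb R).$$ This law exists and has a density $g\ge 0$ which vanishes for $x\le 0$ and is continuous for $x>0$ (and is uniquely determined by this). The density is given for all $x$ by the locally finite sum $$g(x)=\sum_{k=0}^\infty g_k(x),$$ where $g_k$ is continuous for $x>0$, non-zero exactly for $x>k$, analytic on $(k,\infty)$, and has the following two equivalent definitions. (i) Let $C_0=\sin(\alpha\pi)/\pi$, let $a(x)=C_0x^{\alpha-1}$ for $x>0$ and $a(x)=0$ otherwise, and let $b(x)=-C_0\,(x-1)^\alpha/x$ for $x>1$ and $b(x)=0$ otherwise. Then $$g_k=a*\underbrace{b*\cdots*b}_{k\text{ times}},$$ where $(u*v)(x)=\int_{\mathbb R}u(t)v(x-t)\,dt$ and all the integrals converge absolutely. (ii) Let $\beta_k=\alpha+k(1+\alpha)$, $C_k=\dfrac1{\Gamma(1-\alpha)\,\Gamma(-\alpha)^k\,\Gamma(\beta_k)}$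 and $(y)_n=\Gamma(y+n)/\Gamma(y)$. Then $g_k$ is the function that vanishes for $x\le k$, is given for $k<x<k+1$ by $$g_k(x)=C_k(x-k)^{\beta_k-1}\sum_{n_1,\dots,n_k\ge0}\frac{(1+\alpha)_{n_1}\cdots(1+\alpha)_{n_k}}{(\beta_k)_{n_1+\cdots+n_k}}\,(k-x)^{n_1+\cdots+n_k},$$ the series being convergent, and for $x\ge k+1$ by analytic continuation along $(k,\infty)$. -/

import Mathlib

open MeasureTheory Set

noncomputable section

namespace DarlingMandelbrot

/-- The characteristic function
`φ_α(s) = (1 - ∑_{n ≥ 1} α / (n - α) * (i s)^n / n!)⁻¹`; the sum is re-indexed by `n = m + 1`. -/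
def phi (α s : ℝ) : ℂ :=
  (1 - ∑' m : ℕ, (α : ℂ) / (((m + 1 : ℕ) : ℂ) - (α : ℂ)) *
    ((Complex.I * (s : ℂ)) ^ (m + 1) / ((m + 1).factorial : ℂ)))⁻¹

/-- The Darling–Mandelbrot law of parameter `α`: the probability measure on `ℝ` whose
characteristic function is `φ_α`. -/
def IsLaw (α : ℝ) (μ : Measure ℝ) : Prop :=
  IsProbabilityMeasure μ ∧ ∀ s : ℝ, charFun μ s = phi α s

/-- `g` is the density of `μ` with respect to Lebesgue measure, in its version that vanishes for
`x ≤ 0` and is continuous for `x > 0`. -/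
def IsContDensity (μ : Measure ℝ) (g : ℝ → ℝ) : Prop :=
  (∀ x, 0 ≤ g x) ∧ (∀ x ≤ 0, g x = 0) ∧ ContinuousOn g (Ioi 0) ∧
    μ = volume.withDensity (fun x => ENNReal.ofReal (g x))

/-- `C_0 = sin(α π) / π`. -/
def C0 (α : ℝ) : ℝ := Real.sin (α * Real.pi) / Real.pi

/-- `a(x) = C_0 x^(α-1)` for `x > 0`, and `0` otherwise. -/
def a (α : ℝ) : ℝ → ℝ :=
  (Ioi (0 : ℝ)).indicator fun x => C0 α * x ^ (α - 1)

/-- `b(x) = -C_0 (x-1)^α / x` for `x > 1`, and `0` otherwise. -/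
def b (α : ℝ) : ℝ → ℝ :=
  (Ioi (1 : ℝ)).indicator fun x => -C0 α * ((x - 1) ^ α / x)

/-- The convolution product `a * b * ⋯ * b` with `k` factors `b`, bracketed from the left:
each step is `(u * v)(x) = ∫ u(t) v(x - t) dt`. -/
def gConv (α : ℝ) : ℕ → ℝ → ℝ
  | 0 => a α
  | k + 1 => convolution (gConv α k) (b α) (ContinuousLinearMap.mul ℝ ℝ) volume

/-- The rising factorial `(y)_n = Γ(y + n) / Γ(y)`. -/
def rising (y : ℝ) (n : ℕ) : ℝ := Real.Gamma (y + n) / Real.Gamma y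

/-- `β_k = α + k (1 + α)`. -/
def beta (α : ℝ) (k : ℕ) : ℝ := α + k * (1 + α)

/-- `C_k = 1 / (Γ(1-α) Γ(-α)^k Γ(β_k))`. -/
def C (α : ℝ) (k : ℕ) : ℝ :=
  1 / (Real.Gamma (1 - α) * Real.Gamma (-α) ^ k * Real.Gamma (beta α k))

/-- The term of index `(n_1, …, n_k)` of the multiple power series at the point `x`. -/
def seriesTerm (α : ℝ) (k : ℕ) (x : ℝ) (n : Fin k → ℕ) : ℝ :=
  (∏ i, rising (1 + α) (n i)) / rising (beta α k) (∑ i, n i) * ((k : ℝ) - x) ^ (∑ i, n i)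

/-- `f` vanishes for `x ≤ k`, is given by the convergent multiple power series for
`k < x < k + 1`, and by its analytic continuation along `(k, ∞)` for `x ≥ k + 1`. -/
def IsSeriesFunction (α : ℝ) (k : ℕ) (f : ℝ → ℝ) : Prop :=
  (∀ x ≤ (k : ℝ), f x = 0) ∧
  (∀ x ∈ Ioo (k : ℝ) (k + 1), Summable (seriesTerm α k x) ∧
    f x = C α k * (x - k) ^ (beta α k - 1) * ∑' n : Fin k → ℕ, seriesTerm α k x n) ∧
  AnalyticOnNhd ℝ f (Ioi (k : ℝ))

end DarlingMandelbrot

end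

/-!
The Laplace transform `t^(-α) / Γ(1 - α)` of `a` belongs to the potential density of a stable
subordinator whose jumps of size `≥ 1` have density `J(x) = α x^(-α-1)`, and `-b = a * J`. Hence
a solution `g` of the renewal equation `g = a + g * b` has Laplace transform `1 / Λ` with
`Λ(t) = t^α Γ(1 - α) + ∫_1^∞ J(x) e^(-tx) dx = e^(-t) + t ∫_0^1 x^(-α) e^(-tx) dx`. The last
expression is entire in `t` and equals `1 / φ_α(s)` at `t = -is`, so the identity theorem on the
half-plane `Re t > 0`, continued to the boundary, gives the characteristic function.

Since `b` is supported in `[1, ∞)`, iterating the renewal equation gives the locally finite sum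
`g = ∑ a * b * ⋯ * b`, but its terms alternate in sign. Positivity comes from another solution of
the same equation. Cut `a` off at level `1` to `a₁` and let `p` be the density of the position at
the first passage above `1`; then `a = a₁ + p * a`. Splitting off the passages by jumps `≥ 1`,
`p = a₁ * J + s` with `s ≥ 0`, whence `a = (a₁ + a₁ * (-b)) + a * s`, and
`g = a₁ + a₁ * s + a₁ * s * s + ⋯ ≥ 0` solves the renewal equation.

Up to a constant and the power `(x - k)^(β_k - 1)`, convolution with `b` acts on the terms by an
integral against a Beta kernel. It preserves positivity and holomorphy on `Re z > -1`, and expanding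
its geometric factor produces the multiple power series.
-/

noncomputable section

namespace DarlingMandelbrot

open Filter Topology
open scoped ENNReal

section ParametricIntegral

variable {X : Type*} [TopologicalSpace X] [T2Space X] [MeasurableSpace X] [OpensMeasurableSpace X]
  {μ : Measure X} {w : X → ℝ} {K : Set X} {U : Set ℂ} {F : ℂ → X → ℂ}

lemma integrableOn_smul_slice (hw : IntegrableOn w K μ) (hK : IsCompact K)
    (hF : ContinuousOn (Function.uncurry F) (U ×ˢ K)) {z : ℂ} (hz : z ∈ U) :
    IntegrableOn (fun t => w t • F z t) K μ :=
  hw.smul_continuousOn (hF.uncurry_left z hz) hK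

lemma aestronglyMeasurable_deriv_slice (hK : IsCompact K) (hU : IsOpen U)
    (hF : ContinuousOn (Function.uncurry F) (U ×ˢ K))
    (hF' : ∀ t ∈ K, DifferentiableOn ℂ (F · t) U) {z : ℂ} (hz : z ∈ U) :
    AEStronglyMeasurable (fun t => deriv (F · t) z) (μ.restrict K) := by
  obtain ⟨u, hu, hmem⟩ := exists_seq_forall_of_frequently
    (eventually_mem_set.2 (mem_nhdsWithin_of_mem_nhds (hU.mem_nhds hz)) :
      ∀ᶠ ζ in 𝓝[≠] z, ζ ∈ U).frequently
  refine aestronglyMeasurable_of_tendsto_ae atTop (f := fun n t => slope (F · t) z (u n))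
    (fun n => ?_) ((ae_restrict_iff' hK.measurableSet).2 (.of_forall fun t ht => ?_))
  · simp only [slope_def_field, div_eq_inv_mul]
    exact (((hF.uncurry_left _ (hmem n)).sub (hF.uncurry_left z hz)).aestronglyMeasurable
      hK.measurableSet).const_mul _
  · exact ((hF' t ht).differentiableAt (hU.mem_nhds hz)).hasDerivAt.tendsto_slope.comp hu

lemma differentiableOn_integral_smul (hw : IntegrableOn w K μ) (hK : IsCompact K) (hU : IsOpen U)
    (hF : ContinuousOn (Function.uncurry F) (U ×ˢ K))
    (hF' : ∀ t ∈ K, DifferentiableOn ℂ (F · t) U) :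
    DifferentiableOn ℂ (fun z => ∫ t in K, w t • F z t ∂μ) U := by
  intro z₀ hz₀
  obtain ⟨r, hr, hball⟩ := Metric.nhds_basis_closedBall.mem_iff.1 (hU.mem_nhds hz₀)
  obtain ⟨M, hM⟩ := ((isCompact_closedBall z₀ r).prod hK).exists_bound_of_continuousOn
    (hF.mono (prod_mono hball le_rfl))
  have hsub : ∀ z ∈ Metric.ball z₀ (r / 2), Metric.closedBall z (r / 2) ⊆ Metric.closedBall z₀ r :=
    fun z hz => Metric.closedBall_subset_closedBall' (by linarith [Metric.mem_ball.1 hz])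
  have hderiv : ∀ t ∈ K, ∀ z ∈ Metric.ball z₀ (r / 2), ‖deriv (F · t) z‖ ≤ M / (r / 2) :=
    fun t ht z hz => Complex.norm_deriv_le_of_forall_mem_sphere_norm_le (half_pos hr)
      (((hF' t ht).mono ((hsub z hz).trans hball)).diffContOnCl_ball subset_rfl)
      fun ζ hζ => hM (ζ, t) ⟨hsub z hz (Metric.sphere_subset_closedBall hζ), ht⟩
  refine (hasDerivAt_integral_of_dominated_loc_of_deriv_le (F := fun z t => w t • F z t)
    (F' := fun z t => w t • deriv (F · t) z) (bound := fun t => ‖w t‖ * (M / (r / 2)))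
    (Metric.ball_mem_nhds z₀ (half_pos hr)) ?_ (integrableOn_smul_slice hw hK hF hz₀)
    (hw.1.smul (aestronglyMeasurable_deriv_slice hK hU hF hF' hz₀)) ?_ (hw.norm.mul_const _)
    ?_).2.differentiableAt.differentiableWithinAt
  · filter_upwards [hU.mem_nhds hz₀] with z hz using (integrableOn_smul_slice hw hK hF hz).1
  · refine (ae_restrict_iff' hK.measurableSet).2 (.of_forall fun t ht z hz => ?_)
    rw [norm_smul]
    gcongr
    exact hderiv t ht z hz
  · refine (ae_restrict_iff' hK.measurableSet).2 (.of_forall fun t ht z hz => ?_)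
    exact (((hF' t ht).differentiableAt (hU.mem_nhds (hball (hsub z hz
      (Metric.mem_closedBall_self (half_pos hr).le))))).hasDerivAt).const_smul (w t)

end ParametricIntegral

section BetaKernel

/-- The integrand `t^(u-1) (1-t)^(v-1)` of Euler's Beta integral, meant for `t ∈ (0, 1)`. -/
def betaKernel (u v t : ℝ) : ℝ := t ^ (u - 1) * (1 - t) ^ (v - 1)

variable {u v t : ℝ}

lemma betaKernel_pos (ht : t ∈ Ioo (0 : ℝ) 1) : 0 < betaKernel u v t :=
  mul_pos (Real.rpow_pos_of_pos ht.1 _) (Real.rpow_pos_of_pos (sub_pos.2 ht.2) _)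

lemma betaKernel_mul_pow (ht : t ∈ Ioo (0 : ℝ) 1) (m n : ℕ) :
    betaKernel u v t * (t ^ m * (1 - t) ^ n) = betaKernel (u + m) (v + n) t := by
  have ht' : 0 < 1 - t := sub_pos.2 ht.2
  rw [betaKernel, betaKernel, add_sub_right_comm, add_sub_right_comm,
    Real.rpow_add_natCast ht.1.ne', Real.rpow_add_natCast ht'.ne']
  ring

lemma lintegral_betaKernel (hu : 0 < u) (hv : 0 < v) :
    ∫⁻ t in Ioo (0 : ℝ) 1, .ofReal (betaKernel u v t) =
      .ofReal (Real.Gamma u * Real.Gamma v / Real.Gamma (u + v)) := by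
  have hB := ProbabilityTheory.beta_pos hu hv
  have h : ∀ t, ENNReal.ofReal (betaKernel u v t) = .ofReal (ProbabilityTheory.beta u v) *
      .ofReal (1 / ProbabilityTheory.beta u v * t ^ (u - 1) * (1 - t) ^ (v - 1)) := fun t => by
    rw [← ENNReal.ofReal_mul hB.le, betaKernel]
    congr 1
    field_simp
  simp only [h]
  rw [lintegral_const_mul _ (by fun_prop), ← ProbabilityTheory.lintegral_betaPDF,
    ProbabilityTheory.lintegral_betaPDF_eq_one hu hv, mul_one]
  rfl

lemma ae_betaKernel_nonneg : 0 ≤ᵐ[volume.restrict (Ioo (0 : ℝ) 1)] betaKernel u v :=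
  (ae_restrict_iff' measurableSet_Ioo).2 (.of_forall fun _ ht => (betaKernel_pos ht).le)

lemma measurable_betaKernel : Measurable (betaKernel u v) := by
  unfold betaKernel; fun_prop

lemma integrableOn_betaKernel (hu : 0 < u) (hv : 0 < v) :
    IntegrableOn (betaKernel u v) (Ioo 0 1) := by
  refine ⟨measurable_betaKernel.aestronglyMeasurable, ?_⟩
  rw [hasFiniteIntegral_iff_ofReal ae_betaKernel_nonneg, lintegral_betaKernel hu hv]
  exact ENNReal.ofReal_lt_top

lemma integral_betaKernel (hu : 0 < u) (hv : 0 < v) :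
    ∫ t in Ioo (0 : ℝ) 1, betaKernel u v t =
      Real.Gamma u * Real.Gamma v / Real.Gamma (u + v) := by
  rw [integral_eq_lintegral_of_nonneg_ae ae_betaKernel_nonneg
    measurable_betaKernel.aestronglyMeasurable, lintegral_betaKernel hu hv]
  exact ENNReal.toReal_ofReal (ProbabilityTheory.beta_pos hu hv).le

lemma integral_betaKernel_mul_pow (hu : 0 < u) (hv : 0 < v) (m n : ℕ) :
    ∫ t in Ioo (0 : ℝ) 1, betaKernel u v t * (t ^ m * (1 - t) ^ n) =
      Real.Gamma (u + m) * Real.Gamma (v + n) / Real.Gamma (u + v + ↑(m + n)) := by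
  rw [setIntegral_congr_fun measurableSet_Ioo fun t ht => betaKernel_mul_pow ht m n,
    integral_betaKernel (by positivity) (by positivity)]
  push_cast
  ring_nf

end BetaKernel

section KernelIntegral

variable {𝕜 : Type*} [RCLike 𝕜]

/-- The averaging operator `H ↦ ∫₀¹ w(t) H(tz) / (1 + (1-t)z) dt` to which convolution with `b`
reduces once the powers of the variable are split off. It is considered over both `ℝ` and `ℂ`,
in order to extend its values holomorphically. -/
def kernelIntegral (w : ℝ → ℝ) (H : 𝕜 → 𝕜) (z : 𝕜) : 𝕜 :=
  ∫ t in Ioo (0 : ℝ) 1, w t • (H (t • z) / (1 + (1 - t) • z))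

lemma kernelIntegral_ofReal (w h : ℝ → ℝ) {H : ℂ → ℂ} (hH : ∀ x : ℝ, H x = h x) (y : ℝ) :
    kernelIntegral w H y = kernelIntegral w h y := by
  simp only [kernelIntegral, ← integral_complex_ofReal, Complex.real_smul, smul_eq_mul,
    ← Complex.ofReal_mul, hH]
  push_cast
  rfl

lemma smul_mem_halfPlane {z : ℂ} (hz : -1 < z.re) {t : ℝ} (ht : t ∈ Icc (0 : ℝ) 1) :
    -1 < (t • z).re := by
  rw [Complex.real_smul, Complex.re_ofReal_mul]
  rcases ht.1.eq_or_lt with rfl | h0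
  · norm_num
  · nlinarith [ht.2]

lemma one_add_smul_ne_zero {z : ℂ} (hz : -1 < z.re) {t : ℝ} (ht : t ∈ Icc (0 : ℝ) 1) :
    1 + (1 - t) • z ≠ 0 := fun h => by
  have h1 := smul_mem_halfPlane hz (t := 1 - t) ⟨sub_nonneg.2 ht.2, sub_le_self _ ht.1⟩
  have h2 : 1 + ((1 - t) • z).re = 0 := by simpa using congrArg Complex.re h
  linarith

lemma differentiableOn_kernelIntegral {w : ℝ → ℝ} (hw : IntegrableOn w (Ioo 0 1)) {H : ℂ → ℂ}
    (hH : DifferentiableOn ℂ H {z | -1 < z.re}) :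
    DifferentiableOn ℂ (kernelIntegral w H) {z | -1 < z.re} := by
  have hU : IsOpen {z : ℂ | -1 < z.re} := isOpen_lt continuous_const Complex.continuous_re
  have hden : ∀ p ∈ {z : ℂ | -1 < z.re} ×ˢ Icc (0 : ℝ) 1, 1 + (1 - p.2) • p.1 ≠ 0 :=
    fun p hp => one_add_smul_ne_zero hp.1 hp.2
  have hmaps : MapsTo (fun p : ℂ × ℝ => p.2 • p.1) ({z | -1 < z.re} ×ˢ Icc 0 1) {z | -1 < z.re} :=
    fun p hp => smul_mem_halfPlane hp.1 hp.2
  have hcont : ContinuousOn (Function.uncurry fun (z : ℂ) (t : ℝ) =>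
      H (t • z) / (1 + (1 - t) • z)) ({z | -1 < z.re} ×ˢ Icc (0 : ℝ) 1) :=
    (hH.continuousOn.comp (by fun_prop) hmaps).div (by fun_prop) hden
  unfold kernelIntegral
  simp only [← integral_Icc_eq_integral_Ioo]
  refine differentiableOn_integral_smul ((integrableOn_Icc_iff_integrableOn_Ioo).2 hw)
    isCompact_Icc hU hcont fun t ht => ?_
  exact (hH.comp (differentiableOn_id.const_smul t) fun z hz => smul_mem_halfPlane hz ht).div
    (by fun_prop) fun z hz => one_add_smul_ne_zero hz ht

variable {w h : ℝ → ℝ} {y : ℝ}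

lemma integrableOn_kernelIntegrand (hw : IntegrableOn w (Ioo 0 1)) (hh : ContinuousOn h (Ici 0))
    (hy : 0 ≤ y) :
    IntegrableOn (fun t => w t * (h (t * y) / (1 + (1 - t) * y))) (Ioo 0 1) := by
  rw [← integrableOn_Icc_iff_integrableOn_Ioo] at hw ⊢
  refine hw.mul_continuousOn (.div (hh.comp (by fun_prop) fun t ht => mul_nonneg ht.1 hy)
    (by fun_prop) fun t ht => ?_) isCompact_Icc
  have := mul_nonneg (sub_nonneg.2 ht.2) hy
  positivity

lemma kernelIntegral_pos (hw : IntegrableOn w (Ioo 0 1)) (hw0 : ∀ t ∈ Ioo (0 : ℝ) 1, 0 < w t)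
    (hh : ContinuousOn h (Ici 0)) (hh0 : ∀ x, 0 ≤ x → 0 < h x) (hy : 0 ≤ y) :
    0 < kernelIntegral w h y := by
  have hpos : ∀ t ∈ Ioo (0 : ℝ) 1, 0 < w t * (h (t * y) / (1 + (1 - t) * y)) := fun t ht => by
    have h1 := mul_nonneg (sub_pos.2 ht.2).le hy
    have h2 := hh0 _ (mul_nonneg ht.1.le hy)
    have h3 := hw0 t ht
    positivity
  simp only [kernelIntegral, smul_eq_mul]
  rw [setIntegral_pos_iff_support_of_nonneg_ae ((ae_restrict_iff' measurableSet_Ioo).2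
    (.of_forall fun t ht => (hpos t ht).le)) (integrableOn_kernelIntegrand hw hh hy),
    inter_eq_self_of_subset_right fun t ht => Function.mem_support.2 (hpos t ht).ne']
  simp

variable {ι : Type*} {c : ι → ℝ} {d : ι → ℕ}

lemma hasSum_kernelIntegrand (hh : ∀ y ∈ Ico (0 : ℝ) 1, HasSum (fun i => c i * (-y) ^ d i) (h y))
    (hy : y ∈ Ico (0 : ℝ) 1) {t : ℝ} (ht : t ∈ Ioo (0 : ℝ) 1) :
    HasSum (fun p : ℕ × ι => c p.2 * (w t * (t ^ d p.2 * (1 - t) ^ p.1)) * (-y) ^ (p.1 + d p.2))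
      (w t * (h (t * y) / (1 + (1 - t) * y))) := by
  have hr : |-((1 - t) * y)| < 1 := by
    rw [abs_neg, abs_of_nonneg (mul_nonneg (sub_pos.2 ht.2).le hy.1)]
    exact mul_lt_one_of_nonneg_of_lt_one_right (by linarith [ht.1]) hy.1 hy.2
  have hgeom := hasSum_geometric_of_abs_lt_one hr
  have hpow := hh (t * y) ⟨mul_nonneg ht.1.le hy.1,
    mul_lt_one_of_nonneg_of_lt_one_right ht.2.le hy.1 hy.2⟩
  have hsummable := summable_mul_of_summable_norm hgeom.summable.norm hpow.summable.norm
  have hprod := (hgeom.mul hpow hsummable).mul_left (w t)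
  rw [sub_neg_eq_add, inv_mul_eq_div] at hprod
  refine hprod.congr_fun fun p => ?_
  rw [neg_mul_eq_mul_neg, neg_mul_eq_mul_neg, mul_pow, mul_pow, pow_add]
  ring

lemma integrableOn_mul_pow_mul_pow (hw : IntegrableOn w (Ioo 0 1)) (m n : ℕ) :
    IntegrableOn (fun t => w t * (t ^ m * (1 - t) ^ n)) (Ioo 0 1) := by
  rw [← integrableOn_Icc_iff_integrableOn_Ioo] at hw ⊢
  exact hw.mul_continuousOn (by fun_prop) isCompact_Icc

lemma integral_norm_mul_pow_mul_pow_le (hw : IntegrableOn w (Ioo 0 1)) (m n : ℕ) :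
    ∫ t in Ioo (0 : ℝ) 1, ‖w t * (t ^ m * (1 - t) ^ n)‖ ≤ ∫ t in Ioo (0 : ℝ) 1, ‖w t‖ := by
  refine setIntegral_mono_on (integrableOn_mul_pow_mul_pow hw m n).norm hw.norm measurableSet_Ioo
    fun t ht => ?_
  have ht' : 0 ≤ 1 - t := sub_nonneg.2 ht.2.le
  rw [norm_mul, Real.norm_of_nonneg (mul_nonneg (pow_nonneg ht.1.le m) (pow_nonneg ht' n))]
  exact mul_le_of_le_one_right (norm_nonneg _)
    (mul_le_one₀ (pow_le_one₀ ht.1.le ht.2.le) (pow_nonneg ht' n)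
      (pow_le_one₀ ht' (by linarith [ht.1])))

lemma hasSum_kernelIntegral [Countable ι] (hw : IntegrableOn w (Ioo 0 1))
    (hh : ∀ y ∈ Ico (0 : ℝ) 1, HasSum (fun i => c i * (-y) ^ d i) (h y)) (hy : y ∈ Ico (0 : ℝ) 1) :
    HasSum (fun p : ℕ × ι => c p.2 * (∫ t in Ioo (0 : ℝ) 1, w t * (t ^ d p.2 * (1 - t) ^ p.1)) *
      (-y) ^ (p.1 + d p.2)) (kernelIntegral w h y) := by
  have hgeom : Summable fun n : ℕ => ‖(-y) ^ n‖ := by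
    simpa [abs_of_nonneg hy.1] using summable_geometric_of_lt_one hy.1 hy.2
  have hsum : Summable fun p : ℕ × ι => ∫ t in Ioo (0 : ℝ) 1,
      ‖c p.2 * (w t * (t ^ d p.2 * (1 - t) ^ p.1)) * (-y) ^ (p.1 + d p.2)‖ := by
    have hbound : Summable fun p : ℕ × ι =>
        (∫ t in Ioo (0 : ℝ) 1, ‖w t‖) * ‖(-y) ^ p.1 * (c p.2 * (-y) ^ d p.2)‖ :=
      (hgeom.mul_norm (hh y hy).summable.norm).mul_left _
    refine hbound.of_nonneg_of_le (fun p => integral_nonneg fun t => norm_nonneg _) fun p => ?_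
    calc _ = ‖c p.2‖ * (∫ t in Ioo (0 : ℝ) 1, ‖w t * (t ^ d p.2 * (1 - t) ^ p.1)‖) *
          ‖(-y) ^ (p.1 + d p.2)‖ := by
          rw [← integral_const_mul, ← integral_mul_const]
          simp only [norm_mul]
      _ ≤ ‖c p.2‖ * (∫ t in Ioo (0 : ℝ) 1, ‖w t‖) * ‖(-y) ^ (p.1 + d p.2)‖ := by
          gcongr ?_ * ?_ * ?_
          exact integral_norm_mul_pow_mul_pow_le hw _ _
      _ = _ := by
          simp only [norm_mul, pow_add]
          ring
  have key := hasSum_integral_of_summable_integral_norm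
    (fun p => ((integrableOn_mul_pow_mul_pow hw _ _).const_mul _).mul_const _) hsum
  simp only [integral_mul_const, integral_const_mul] at key
  rwa [setIntegral_congr_fun measurableSet_Ioo fun t ht =>
    (hasSum_kernelIntegrand hh hy ht).tsum_eq] at key

end KernelIntegral

section RegFactor

variable {α : ℝ} (hα0 : 0 < α)

lemma beta_succ (α : ℝ) (k : ℕ) : beta α (k + 1) = beta α k + (1 + α) := by
  rw [beta, beta]; push_cast; ring

/-- The factor of `gConv α k (k + y)` other than `C_0 (-C_0)^k` and the power `y^(β_k - 1)`; over
`ℂ`, its holomorphic extension to the half-plane `Re z > -1`. -/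
def regFactor (𝕜 : Type*) [RCLike 𝕜] (α : ℝ) : ℕ → 𝕜 → 𝕜
  | 0 => 1
  | k + 1 => kernelIntegral (betaKernel (beta α k) (1 + α)) (regFactor 𝕜 α k)

lemma regFactor_ofReal (α : ℝ) (k : ℕ) (y : ℝ) : regFactor ℂ α k y = regFactor ℝ α k y := by
  induction k generalizing y with
  | zero => simp [regFactor]
  | succ k ih => exact kernelIntegral_ofReal _ _ ih y

include hα0

lemma beta_pos (k : ℕ) : 0 < beta α k := by
  unfold beta; positivity

lemma differentiableOn_regFactor (k : ℕ) :
    DifferentiableOn ℂ (regFactor ℂ α k) {z | -1 < z.re} := by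
  induction k with
  | zero => exact differentiableOn_const 1
  | succ k ih =>
    exact differentiableOn_kernelIntegral
      (integrableOn_betaKernel (beta_pos hα0 k) (by positivity)) ih

lemma analyticAt_regFactor (k : ℕ) {y : ℝ} (hy : -1 < y) :
    AnalyticAt ℝ (regFactor ℝ α k) y := by
  have hU : IsOpen {z : ℂ | -1 < z.re} := isOpen_lt continuous_const Complex.continuous_re
  have h := ((differentiableOn_regFactor hα0 k).analyticAt
    (hU.mem_nhds (by simpa using hy : (y : ℂ) ∈ _))).re_ofReal
  simpa only [regFactor_ofReal, Complex.ofReal_re] using h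

lemma continuousOn_regFactor (k : ℕ) : ContinuousOn (regFactor ℝ α k) (Ici 0) :=
  fun _ hy => (analyticAt_regFactor hα0 k (neg_one_lt_zero.trans_le hy)).continuousAt
    |>.continuousWithinAt

lemma regFactor_pos (k : ℕ) {y : ℝ} (hy : 0 ≤ y) : 0 < regFactor ℝ α k y := by
  induction k generalizing y with
  | zero => exact one_pos
  | succ k ih =>
    exact kernelIntegral_pos (integrableOn_betaKernel (beta_pos hα0 k) (by positivity))
      (fun _ ht => betaKernel_pos ht) (continuousOn_regFactor hα0 k) (fun _ hx => ih hx) hy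

end RegFactor

section Series

/-- The coefficient of `(-y)^(n_1 + ⋯ + n_k)` in the expansion of `regFactor ℝ α k y`. -/
def regCoeff (α : ℝ) (k : ℕ) (n : Fin k → ℕ) : ℝ :=
  Real.Gamma α * (∏ i, Real.Gamma (1 + α + n i)) / Real.Gamma (beta α k + ↑(∑ i, n i))

lemma C0_eq (α : ℝ) : C0 α = 1 / (Real.Gamma α * Real.Gamma (1 - α)) := by
  rw [Real.Gamma_mul_Gamma_one_sub, C0, one_div_div, mul_comm]

lemma neg_C0_eq (α : ℝ) : -C0 α = 1 / (Real.Gamma (-α) * Real.Gamma (1 + α)) := by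
  have h := Real.Gamma_mul_Gamma_one_sub (-α)
  rw [sub_neg_eq_add, mul_neg, Real.sin_neg] at h
  rw [h, C0, one_div_div, mul_comm, neg_div]

variable {α : ℝ} (hα0 : 0 < α)
include hα0

lemma regCoeff_cons (k m : ℕ) (n : Fin k → ℕ) :
    regCoeff α (k + 1) (Fin.cons m n) = regCoeff α k n *
      ∫ t in Ioo (0 : ℝ) 1, betaKernel (beta α k) (1 + α) t * (t ^ (∑ i, n i) * (1 - t) ^ m) := by
  have hβ := beta_pos hα0 k
  have hΓ : Real.Gamma (beta α k + ↑(∑ i, n i)) ≠ 0 :=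
    (Real.Gamma_pos_of_pos (by positivity)).ne'
  rw [integral_betaKernel_mul_pow hβ (by positivity), regCoeff, regCoeff, beta_succ,
    Fin.prod_univ_succ, Fin.sum_univ_succ]
  simp only [Fin.cons_zero, Fin.cons_succ]
  rw [add_comm m]
  field_simp

lemma hasSum_regFactor (k : ℕ) {y : ℝ} (hy : y ∈ Ico (0 : ℝ) 1) :
    HasSum (fun n : Fin k → ℕ => regCoeff α k n * (-y) ^ (∑ i, n i)) (regFactor ℝ α k y) := by
  induction k generalizing y with
  | zero =>
    have hΓ : Real.Gamma α ≠ 0 := (Real.Gamma_pos_of_pos hα0).ne'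
    simp [regCoeff, regFactor, beta, hΓ]
  | succ k ih =>
    have h := hasSum_kernelIntegral
      (integrableOn_betaKernel (beta_pos hα0 k) (by positivity : 0 < 1 + α)) (fun y hy => ih hy) hy
    rw [← (Fin.consEquiv fun _ => ℕ).hasSum_iff]
    refine h.congr_fun fun p => ?_
    simp [Fin.consEquiv, regCoeff_cons hα0, Fin.sum_univ_succ]

lemma seriesTerm_eq (k : ℕ) (x : ℝ) (n : Fin k → ℕ) :
    seriesTerm α k x n = Real.Gamma (beta α k) / (Real.Gamma α * Real.Gamma (1 + α) ^ k) *
      (regCoeff α k n * (k - x) ^ (∑ i, n i)) := by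
  have hΓ : Real.Gamma α ≠ 0 := (Real.Gamma_pos_of_pos hα0).ne'
  simp only [seriesTerm, regCoeff, rising, Finset.prod_div_distrib, Finset.prod_const,
    Finset.card_univ, Fintype.card_fin]
  field_simp

lemma hasSum_seriesTerm (k : ℕ) {x : ℝ} (hx : x ∈ Ioo (k : ℝ) (k + 1)) :
    HasSum (seriesTerm α k x) (Real.Gamma (beta α k) / (Real.Gamma α * Real.Gamma (1 + α) ^ k) *
      regFactor ℝ α k (x - k)) := by
  have h := hasSum_regFactor hα0 k (y := x - k) ⟨sub_nonneg.2 hx.1.le, by linarith [hx.2]⟩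
  rw [neg_sub] at h
  simpa only [← seriesTerm_eq hα0] using h.mul_left
    (Real.Gamma (beta α k) / (Real.Gamma α * Real.Gamma (1 + α) ^ k))

lemma C_mul_eq (k : ℕ) :
    C α k * (Real.Gamma (beta α k) / (Real.Gamma α * Real.Gamma (1 + α) ^ k)) =
      C0 α * (-C0 α) ^ k := by
  have hΓ : Real.Gamma (beta α k) ≠ 0 := (Real.Gamma_pos_of_pos (beta_pos hα0 k)).ne'
  rw [neg_C0_eq, C0_eq, C, one_div_pow, mul_pow]
  field_simp

end Series

section SupportedConvolution

variable {f g : ℝ → ℝ} {p q y : ℝ}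

lemma mul_eq_indicator_Ioo_of_eq_zero (hf : ∀ t ≤ p, f t = 0) (hg : ∀ t ≤ q, g t = 0)
    (hy : 0 < y) (t : ℝ) :
    f (p + y * t) * g (p + q + y - (p + y * t)) =
      (Ioo (0 : ℝ) 1).indicator (fun t => f (p + y * t) * g (q + y * (1 - t))) t := by
  by_cases ht : t ∈ Ioo (0 : ℝ) 1
  · rw [indicator_of_mem ht]
    ring_nf
  rw [indicator_of_notMem ht]
  rcases le_or_gt t 0 with h0 | h0
  · rw [hf _ (by nlinarith), zero_mul]
  · rw [hg _ (by nlinarith [not_lt.1 fun h1 => ht ⟨h0, h1⟩]), mul_zero]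

lemma integral_mul_comp_sub_eq (hf : ∀ t ≤ p, f t = 0) (hg : ∀ t ≤ q, g t = 0) (hy : 0 < y) :
    ∫ t, f t * g (p + q + y - t) =
      y * ∫ t in Ioo (0 : ℝ) 1, f (p + y * t) * g (q + y * (1 - t)) := by
  rw [← integral_add_left_eq_self _ p, ← integral_indicator measurableSet_Ioo]
  simp_rw [← mul_eq_indicator_Ioo_of_eq_zero hf hg hy]
  rw [Measure.integral_comp_mul_left (fun t => f (p + t) * g (p + q + y - (p + t))) y,
    abs_of_pos (inv_pos.2 hy), smul_eq_mul, mul_inv_cancel_left₀ hy.ne']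

lemma integrable_mul_comp_sub (hf : ∀ t ≤ p, f t = 0) (hg : ∀ t ≤ q, g t = 0) (hy : 0 < y)
    (h : IntegrableOn (fun t => f (p + y * t) * g (q + y * (1 - t))) (Ioo 0 1)) :
    Integrable fun t => f t * g (p + q + y - t) := by
  rw [← integrable_indicator_iff measurableSet_Ioo,
    ← funext (mul_eq_indicator_Ioo_of_eq_zero hf hg hy),
    integrable_comp_mul_left_iff (fun t => f (p + t) * g (p + q + y - (p + t))) hy.ne'] at h
  simpa using h.comp_sub_right p

lemma mul_comp_sub_eq_zero (hf : ∀ t ≤ p, f t = 0) (hg : ∀ t ≤ q, g t = 0) {x : ℝ}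
    (hx : x ≤ p + q) (t : ℝ) : f t * g (x - t) = 0 := by
  rcases le_or_gt t p with h | h
  · rw [hf t h, zero_mul]
  · rw [hg _ (by linarith), mul_zero]

end SupportedConvolution

section Terms

variable {α : ℝ}

lemma a_of_pos (α : ℝ) {x : ℝ} (hx : 0 < x) : a α x = C0 α * x ^ (α - 1) :=
  indicator_of_mem (mem_Ioi.2 hx) _

lemma a_of_nonpos (α : ℝ) {x : ℝ} (hx : x ≤ 0) : a α x = 0 :=
  indicator_of_notMem (by simpa using hx) _

lemma b_of_one_lt (α : ℝ) {x : ℝ} (hx : 1 < x) : b α x = -C0 α * ((x - 1) ^ α / x) :=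
  indicator_of_mem (mem_Ioi.2 hx) _

lemma b_of_le_one (α : ℝ) {x : ℝ} (hx : x ≤ 1) : b α x = 0 :=
  indicator_of_notMem (by simpa using hx) _

lemma gConv_succ_apply (α : ℝ) (k : ℕ) (x : ℝ) :
    gConv α (k + 1) x = ∫ t, gConv α k t * b α (x - t) := rfl

lemma gConv_of_le (α : ℝ) (k : ℕ) {x : ℝ} (hx : x ≤ k) : gConv α k x = 0 := by
  induction k generalizing x with
  | zero => exact a_of_nonpos α (by simpa using hx)
  | succ k ih =>
    rw [gConv_succ_apply]
    simp only [mul_comp_sub_eq_zero (fun t ht => ih ht) (fun t => b_of_le_one α)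
      (by simpa using hx), integral_zero]

/-- The functions `k + y ↦ c y^(β_k - 1) R(y)` and `b` multiply to the integrand of
`kernelIntegral` when `x = k + 1 + y` is split as `(k + ty) + (1 + (1 - t)y)`. -/
lemma mul_b_eq (R : ℝ → ℝ) (c β : ℝ) {y t : ℝ} (hy : 0 < y) (ht : t ∈ Ioo (0 : ℝ) 1) :
    c * (y * t) ^ (β - 1) * R (y * t) * b α (1 + y * (1 - t)) =
      c * -C0 α * y ^ (β - 1 + α) *
        (betaKernel β (1 + α) t * (R (t * y) / (1 + (1 - t) * y))) := by
  have ht' : 0 < 1 - t := sub_pos.2 ht.2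
  rw [b_of_one_lt α (lt_add_of_pos_right 1 (mul_pos hy ht')), add_sub_cancel_left, betaKernel,
    Real.mul_rpow hy.le ht.1.le, Real.mul_rpow hy.le ht'.le, Real.rpow_add hy, add_sub_cancel_left,
    mul_comm t y, mul_comm (1 - t) y]
  ring

lemma gConv_add (k : ℕ) {y : ℝ} (hy : 0 < y) :
    gConv α k (k + y) =
      C0 α * (-C0 α) ^ k * y ^ (beta α k - 1) * regFactor ℝ α k y := by
  induction k generalizing y with
  | zero => simp [gConv, a_of_pos α hy, regFactor, beta]
  | succ k ih =>
    have hint : ∀ t ∈ Ioo (0 : ℝ) 1, gConv α k (k + y * t) * b α (1 + y * (1 - t)) =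
        C0 α * (-C0 α) ^ k * -C0 α * y ^ (beta α k - 1 + α) * (betaKernel (beta α k) (1 + α) t *
          (regFactor ℝ α k (t * y) / (1 + (1 - t) * y))) := fun t ht => by
      rw [ih (mul_pos hy ht.1), mul_b_eq _ _ _ hy ht]
    rw [gConv_succ_apply, Nat.cast_succ, integral_mul_comp_sub_eq (fun t => gConv_of_le α k)
      (fun t => b_of_le_one α) hy, setIntegral_congr_fun measurableSet_Ioo hint,
      integral_const_mul, regFactor, kernelIntegral, beta_succ,
      show beta α k + (1 + α) - 1 = beta α k - 1 + α + 1 by ring, Real.rpow_add_one hy.ne']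
    simp only [smul_eq_mul]
    ring

lemma gConv_of_lt (k : ℕ) {x : ℝ} (hx : (k : ℝ) < x) :
    gConv α k x = C0 α * (-C0 α) ^ k * (x - k) ^ (beta α k - 1) * regFactor ℝ α k (x - k) := by
  rw [← gConv_add k (sub_pos.2 hx), add_sub_cancel]

variable (hα0 : 0 < α)
include hα0

lemma convolutionExists_gConv_b (k : ℕ) :
    ConvolutionExists (gConv α k) (b α) (ContinuousLinearMap.mul ℝ ℝ) volume := by
  intro x
  change Integrable fun t => gConv α k t * b α (x - t)
  rcases le_or_gt x (k + 1) with hx | hx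
  · simp only [mul_comp_sub_eq_zero (fun _ => gConv_of_le α k) (fun _ => b_of_le_one α) hx]
    exact integrable_zero _ _ _
  · obtain ⟨y, hy, rfl⟩ : ∃ y, 0 < y ∧ x = k + 1 + y := ⟨x - (k + 1), sub_pos.2 hx, by ring⟩
    refine integrable_mul_comp_sub (fun t => gConv_of_le α k) (fun t => b_of_le_one α) hy ?_
    have hint := (integrableOn_kernelIntegrand (integrableOn_betaKernel (beta_pos hα0 k)
      (by positivity : 0 < 1 + α)) (continuousOn_regFactor hα0 k) hy.le).const_mul
      (C0 α * (-C0 α) ^ k * -C0 α * y ^ (beta α k - 1 + α))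
    refine IntegrableOn.congr_fun hint (fun t ht => ?_) measurableSet_Ioo
    rw [gConv_add k (mul_pos hy ht.1), mul_b_eq _ _ _ hy ht]

lemma analyticOnNhd_gConv (k : ℕ) : AnalyticOnNhd ℝ (gConv α k) (Ioi (k : ℝ)) := by
  intro x hx
  have hsub : AnalyticAt ℝ (fun x : ℝ => x - k) x := analyticAt_id.sub analyticAt_const
  have hpow : AnalyticAt ℝ (fun x : ℝ => (x - k) ^ (beta α k - 1)) x := by
    refine ((hsub.log (sub_pos.2 hx)).mul (analyticAt_const (v := beta α k - 1))).rexp.congr ?_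
    filter_upwards [isOpen_Ioi.mem_nhds hx] with z hz
      using (Real.rpow_def_of_pos (sub_pos.2 hz) _).symm
  have hreg : AnalyticAt ℝ (fun x : ℝ => regFactor ℝ α k (x - k)) x :=
    AnalyticAt.comp (analyticAt_regFactor hα0 k (neg_one_lt_zero.trans (sub_pos.2 hx))) hsub
  refine (((analyticAt_const (v := C0 α * (-C0 α) ^ k)).mul hpow).mul hreg).congr ?_
  filter_upwards [isOpen_Ioi.mem_nhds hx] with z hz using (gConv_of_lt k hz).symm

lemma continuousOn_gConv (k : ℕ) : ContinuousOn (gConv α k) (Ioi 0) := by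
  cases k with
  | zero => simpa using (analyticOnNhd_gConv hα0 0).continuousOn
  | succ k =>
    have hexp : 0 < beta α (k + 1) - 1 := by
      rw [beta_succ]; linarith [beta_pos hα0 k]
    have heq : gConv α (k + 1) = fun x : ℝ => C0 α * (-C0 α) ^ (k + 1) *
        max (x - (k + 1 : ℕ)) 0 ^ (beta α (k + 1) - 1) *
          regFactor ℝ α (k + 1) (max (x - (k + 1 : ℕ)) 0) := by
      ext x
      rcases le_or_gt x (k + 1 : ℕ) with h | h
      · rw [gConv_of_le α _ h, max_eq_right (sub_nonpos.2 h), Real.zero_rpow hexp.ne', mul_zero,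
          zero_mul]
      · rw [gConv_of_lt _ h, max_eq_left (sub_pos.2 h).le]
    rw [heq]
    refine (((Continuous.rpow_const (by fun_prop) fun x => .inr hexp.le).const_mul _).mul
      ((continuousOn_regFactor hα0 (k + 1)).comp_continuous (by fun_prop)
        fun x => mem_Ici.2 (le_max_right _ _))).continuousOn

variable (hα1 : α < 1)

lemma isSeriesFunction_gConv (k : ℕ) : IsSeriesFunction α k (gConv α k) := by
  refine ⟨fun x => gConv_of_le α k, fun x hx => ?_, analyticOnNhd_gConv hα0 k⟩
  have h := hasSum_seriesTerm hα0 k hx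
  refine ⟨h.summable, ?_⟩
  rw [h.tsum_eq, gConv_of_lt k hx.1, ← C_mul_eq hα0]
  ring

include hα1

lemma C0_pos : 0 < C0 α :=
  div_pos (Real.sin_pos_of_pos_of_lt_pi (by positivity) (by nlinarith [Real.pi_pos])) Real.pi_pos

lemma support_gConv (k : ℕ) : Function.support (gConv α k) = Ioi (k : ℝ) := by
  ext x
  rw [Function.mem_support, mem_Ioi]
  refine ⟨fun h => lt_of_not_ge fun h' => h (gConv_of_le α k h'), fun h => ?_⟩
  have hx : 0 < x - k := sub_pos.2 h
  have hC := (C0_pos hα0 hα1).ne'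
  rw [gConv_of_lt k h]
  exact mul_ne_zero (mul_ne_zero (mul_ne_zero hC (pow_ne_zero k (neg_ne_zero.2 hC)))
    (Real.rpow_pos_of_pos hx _).ne') (regFactor_pos hα0 k hx.le).ne'

lemma locallyFinite_support_gConv : LocallyFinite fun k : ℕ => Function.support (gConv α k) := by
  intro x
  obtain ⟨n, hn⟩ := exists_nat_gt x
  refine ⟨Iio (n : ℝ), isOpen_Iio.mem_nhds hn, (finite_lt_nat n).subset ?_⟩
  rintro k ⟨z, hz, hz'⟩
  simp only [support_gConv hα0 hα1] at hz
  exact_mod_cast lt_trans (mem_Ioi.1 hz) hz'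

end Terms

lemma IsSeriesFunction.eq {α : ℝ} {k : ℕ} {f g : ℝ → ℝ} (hf : IsSeriesFunction α k f)
    (hg : IsSeriesFunction α k g) : f = g := by
  ext x
  rcases le_or_gt x k with hx | hx
  · rw [hf.1 x hx, hg.1 x hx]
  · have hmem : (k : ℝ) + 1 / 2 ∈ Ioo (k : ℝ) (k + 1) := ⟨by linarith, by linarith⟩
    refine hf.2.2.eqOn_of_preconnected_of_eventuallyEq hg.2.2 isPreconnected_Ioi
      (mem_Ioi.2 hmem.1) ?_ hx
    filter_upwards [isOpen_Ioo.mem_nhds hmem] with z hz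
    rw [(hf.2.1 z hz).2, (hg.2.1 z hz).2]

section Renewal

variable {f g k : ℝ → ℝ≥0∞} {p q x : ℝ}

lemma lconvolution_eq_setLIntegral (hf : ∀ t ≤ p, f t = 0) (hg : ∀ t < q, g t = 0) :
    (f ⋆ₗ g) x = ∫⁻ t in Ioc p (x - q), f t * g (x - t) := by
  rw [lconvolution_def, ← lintegral_indicator measurableSet_Ioc]
  refine lintegral_congr fun t => ?_
  rw [neg_add_eq_sub]
  by_cases ht : t ∈ Ioc p (x - q)
  · rw [indicator_of_mem ht]
  rw [indicator_of_notMem ht]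
  rcases le_or_gt t p with h | h
  · rw [hf t h, zero_mul]
  · rw [hg _ (by linarith [not_le.1 fun h' => ht ⟨h, h'⟩]), mul_zero]

lemma lconvolution_of_le (hf : ∀ t ≤ p, f t = 0) (hg : ∀ t < q, g t = 0) (hx : x ≤ p + q) :
    (f ⋆ₗ g) x = 0 := by
  rw [lconvolution_eq_setLIntegral hf hg, Ioc_eq_empty (by linarith), setLIntegral_empty]

lemma add_lconvolution (hf : Measurable f) (hk : Measurable k) :
    (f + g) ⋆ₗ k = f ⋆ₗ k + g ⋆ₗ k := by
  ext x
  simp only [lconvolution_def, Pi.add_apply, add_mul]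
  exact lintegral_add_left (by fun_prop) _

/-- The convolution of `f` with `n` factors `s`. -/
def lconvIter (f s : ℝ → ℝ≥0∞) : ℕ → ℝ → ℝ≥0∞
  | 0 => f
  | n + 1 => lconvIter f s n ⋆ₗ s

/-- The renewal sum `f + f * s + f * s * s + ⋯`, the solution of `u = f + u * s`. -/
def renewalSum (f s : ℝ → ℝ≥0∞) (x : ℝ) : ℝ≥0∞ := ∑' n, lconvIter f s n x

variable {r s u v : ℝ → ℝ≥0∞}

@[fun_prop]
lemma measurable_lconvIter (hf : Measurable f) (hs : Measurable s) (n : ℕ) :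
    Measurable (lconvIter f s n) := by
  induction n with
  | zero => exact hf
  | succ n ih => exact measurable_lconvolution _ ih hs

lemma measurable_renewalSum (hf : Measurable f) (hs : Measurable s) :
    Measurable (renewalSum f s) := by
  unfold renewalSum; fun_prop

lemma lconvIter_of_le (hf : ∀ t ≤ 0, f t = 0) (hs : ∀ t ≤ 1, s t = 0) (n : ℕ) (hx : x ≤ n) :
    lconvIter f s n x = 0 := by
  induction n generalizing x with
  | zero => exact hf x (by simpa using hx)
  | succ n ih =>
    exact lconvolution_of_le (fun t ht => ih ht) (fun t ht => hs t ht.le) (by simpa using hx)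

variable (hv : Measurable v) (hr : Measurable r) (hs : Measurable s)
  (h : u = v + v ⋆ₗ r + u ⋆ₗ s)
include hv hr hs h

lemma lconvIter_eq (n : ℕ) :
    lconvIter u s n = lconvIter v s n + lconvIter v s n ⋆ₗ r + lconvIter u s (n + 1) := by
  induction n with
  | zero => exact h
  | succ n ih =>
    have hcomm : (lconvIter v s n ⋆ₗ r) ⋆ₗ s = (lconvIter v s n ⋆ₗ s) ⋆ₗ r := by
      have hn := measurable_lconvIter hv hs n
      rw [← lconvolution_assoc hn hr hs, lconvolution_comm (f := r), lconvolution_assoc hn hs hr]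
    have hn := measurable_lconvIter hv hs n
    calc lconvIter u s n ⋆ₗ s
      _ = (lconvIter v s n + lconvIter v s n ⋆ₗ r + lconvIter u s (n + 1)) ⋆ₗ s := by rw [← ih]
      _ = _ := by rw [add_lconvolution (by fun_prop) hs, add_lconvolution hn hs, hcomm]; rfl

lemma eq_sum_lconvIter_add (N : ℕ) :
    u = ∑ n ∈ Finset.range N, (lconvIter v s n + lconvIter v s n ⋆ₗ r) + lconvIter u s N := by
  induction N with
  | zero => simp [lconvIter]
  | succ N ih =>
    rwa [Finset.sum_range_succ, add_assoc, ← lconvIter_eq hv hr hs h]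

lemma renewalSum_add_lconvolution (hu0 : ∀ t ≤ 0, u t = 0) (hs0 : ∀ t ≤ 1, s t = 0) :
    renewalSum v s + renewalSum v s ⋆ₗ r = u := by
  ext x
  obtain ⟨N, hN⟩ := exists_nat_ge x
  have hlin : (renewalSum v s ⋆ₗ r) x = ∑' n, (lconvIter v s n ⋆ₗ r) x := by
    simp only [lconvolution_def, renewalSum, ← ENNReal.tsum_mul_right]
    exact lintegral_tsum fun n => by fun_prop
  have hzero : ∀ n ∉ Finset.range N, lconvIter v s n x + (lconvIter v s n ⋆ₗ r) x = 0 := by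
    intro n hn
    have hNn : (N : ℝ) ≤ n := by exact_mod_cast (by simpa using hn : N ≤ n)
    have hx := congrFun (lconvIter_eq hv hr hs h n) x
    rw [lconvIter_of_le hu0 hs0 n (hN.trans hNn)] at hx
    exact (add_eq_zero.1 hx.symm).1
  rw [Pi.add_apply, hlin, renewalSum, ← ENNReal.tsum_add, tsum_eq_sum hzero]
  conv_rhs => rw [eq_sum_lconvIter_add hv hr hs h N]
  simp only [Pi.add_apply, Finset.sum_apply, lconvIter_of_le hu0 hs0 N hN, add_zero]

end Renewal

section Subordinator

variable (α : ℝ)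

/-- The function `a` with values in `[0, ∞]`: the potential density of a stable subordinator. -/
def aE (x : ℝ) : ℝ≥0∞ := ENNReal.ofReal (a α x)

/-- The function `-b` with values in `[0, ∞]`. -/
def bE (x : ℝ) : ℝ≥0∞ := ENNReal.ofReal (-b α x)

/-- The restriction of `aE` to `(-∞, 1]`. -/
def aTrunc : ℝ → ℝ≥0∞ := (Iic 1).indicator (aE α)

/-- The density `α x^(-α-1)` of the jumps of size at least `1` of the subordinator. -/
def jump : ℝ → ℝ≥0∞ := (Ici 1).indicator fun x => .ofReal (α * x ^ (-α - 1))

/-- The density of the position of the subordinator on first passage above the level `1`. -/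
def passage : ℝ → ℝ≥0∞ := (Ioi 1).indicator fun x => .ofReal (C0 α * ((x - 1) ^ (-α) / x))

/-- The part of `passage` due to jumps of size less than `1`. -/
def smallPassage : ℝ → ℝ≥0∞ := passage α - aTrunc α ⋆ₗ jump α

@[fun_prop]
lemma measurable_a : Measurable (a α) := Measurable.indicator (by fun_prop) measurableSet_Ioi

@[fun_prop]
lemma measurable_b : Measurable (b α) := Measurable.indicator (by fun_prop) measurableSet_Ioi

@[fun_prop]
lemma measurable_aE : Measurable (aE α) := (measurable_a α).ennreal_ofReal

@[fun_prop]
lemma measurable_bE : Measurable (bE α) := (measurable_b α).neg.ennreal_ofReal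

@[fun_prop]
lemma measurable_aTrunc : Measurable (aTrunc α) := (measurable_aE α).indicator measurableSet_Iic

@[fun_prop]
lemma measurable_jump : Measurable (jump α) :=
  Measurable.indicator (by fun_prop) measurableSet_Ici

@[fun_prop]
lemma measurable_passage : Measurable (passage α) :=
  Measurable.indicator (by fun_prop) measurableSet_Ioi

@[fun_prop]
lemma measurable_smallPassage : Measurable (smallPassage α) :=
  (measurable_passage α).sub (measurable_lconvolution _ (measurable_aTrunc α) (measurable_jump α))

variable {x : ℝ}

lemma aE_of_nonpos (hx : x ≤ 0) : aE α x = 0 := by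
  rw [aE, a_of_nonpos α hx, ENNReal.ofReal_zero]

lemma bE_of_le_one (hx : x ≤ 1) : bE α x = 0 := by
  rw [bE, b_of_le_one α hx, neg_zero, ENNReal.ofReal_zero]

lemma aTrunc_of_nonpos (hx : x ≤ 0) : aTrunc α x = 0 := by
  simp [aTrunc, indicator_apply, aE_of_nonpos α hx]

lemma jump_of_lt_one (hx : x < 1) : jump α x = 0 := indicator_of_notMem (notMem_Ici.2 hx) _

lemma passage_of_le_one (hx : x ≤ 1) : passage α x = 0 := indicator_of_notMem (notMem_Ioi.2 hx) _

lemma smallPassage_of_le_one (hx : x ≤ 1) : smallPassage α x = 0 := by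
  simp [smallPassage, passage_of_le_one α hx]

lemma hasDerivAt_rpow_mul_sub_rpow_neg {t : ℝ} (ht : t ∈ Ioo 0 x) :
    HasDerivAt (fun t => t ^ α * (x - t) ^ (-α) / x)
      (t ^ (α - 1) * (α * (x - t) ^ (-α - 1))) t := by
  have ht0 := ht.1
  have hxt : 0 < x - t := sub_pos.2 ht.2
  have hx : x ≠ 0 := (ht0.trans ht.2).ne'
  have h := ((Real.hasDerivAt_rpow_const (p := α) (.inl ht0.ne')).mul
    (((hasDerivAt_id t).const_sub x).rpow_const (p := -α) (.inl hxt.ne'))).div_const x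
  convert! h using 1
  simp only [id_eq]
  rw [← sub_add_cancel α 1, ← sub_add_cancel (-(α - 1 + 1)) 1, Real.rpow_add_one ht0.ne',
    Real.rpow_add_one hxt.ne', sub_add_cancel, sub_add_cancel, eq_div_iff hx]
  ring

variable {α} (hα0 : 0 < α) (hα1 : α < 1)
include hα0

lemma integral_rpow_mul_sub_rpow_neg {m : ℝ} (hm : m ∈ Ico 0 x) :
    IntegrableOn (fun t => t ^ (α - 1) * (α * (x - t) ^ (-α - 1))) (Ioc 0 m) ∧
      ∫ t in Ioc 0 m, t ^ (α - 1) * (α * (x - t) ^ (-α - 1)) = m ^ α * (x - m) ^ (-α) / x := by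
  have hsub : ∀ t ∈ Icc 0 m, x - t ≠ 0 := fun t ht => by linarith [ht.2, hm.2]
  have hcont : ContinuousOn (fun t : ℝ => t ^ α * (x - t) ^ (-α) / x) (Icc 0 m) :=
    ((Real.continuous_rpow_const hα0.le).continuousOn.mul
      (ContinuousOn.rpow_const (by fun_prop) fun t ht => .inl (hsub t ht))).div_const x
  have hint : IntervalIntegrable (fun t : ℝ => t ^ (α - 1) * (α * (x - t) ^ (-α - 1)))
      volume 0 m := by
    refine (intervalIntegral.intervalIntegrable_rpow' (by linarith)).mul_continuousOn ?_
    rw [uIcc_of_le hm.1]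
    exact continuousOn_const.mul
      (ContinuousOn.rpow_const (by fun_prop) fun t ht => .inl (hsub t ht))
  have hftc := intervalIntegral.integral_eq_sub_of_hasDerivAt_of_le hm.1 hcont
    (fun t ht => hasDerivAt_rpow_mul_sub_rpow_neg α ⟨ht.1, ht.2.trans hm.2⟩) hint
  rw [intervalIntegral.integral_of_le hm.1, Real.zero_rpow hα0.ne', zero_mul, zero_div,
    sub_zero] at hftc
  exact ⟨(intervalIntegrable_iff_integrableOn_Ioc_of_le hm.1).1 hint, hftc⟩

include hα1

lemma lintegral_aE_mul_jump {m : ℝ} (hm : 0 ≤ m) (hmx : m ≤ x - 1) :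
    ∫⁻ t in Ioc 0 m, aE α t * jump α (x - t) =
      .ofReal (C0 α * (m ^ α * (x - m) ^ (-α) / x)) := by
  have hC := (C0_pos hα0 hα1).le
  obtain ⟨hint, heq⟩ := integral_rpow_mul_sub_rpow_neg hα0 (x := x) ⟨hm, by linarith⟩
  rw [← heq, ← integral_const_mul, ofReal_integral_eq_lintegral_ofReal (hint.const_mul _)]
  · refine setLIntegral_congr_fun measurableSet_Ioc fun t ht => ?_
    have ht0 := ht.1
    rw [aE, a_of_pos α ht0, jump, indicator_of_mem (mem_Ici.2 (by linarith [ht.2])),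
      ← ENNReal.ofReal_mul (by positivity), mul_assoc]
  · refine (ae_restrict_iff' measurableSet_Ioc).2 (.of_forall fun t ht => ?_)
    have ht0 := ht.1
    have hxt : 0 ≤ x - t := by linarith [ht.2]
    simp only [Pi.zero_apply]
    positivity

lemma lconvolution_aE_jump : aE α ⋆ₗ jump α = bE α := by
  ext x
  rw [lconvolution_eq_setLIntegral (fun t => aE_of_nonpos α) (fun t => jump_of_lt_one α)]
  rcases le_or_gt x 1 with hx | hx
  · rw [bE_of_le_one α hx, Ioc_eq_empty (by linarith), setLIntegral_empty]
  · rw [lintegral_aE_mul_jump hα0 hα1 (sub_pos.2 hx).le le_rfl, bE, b_of_one_lt α hx]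
    simp

lemma lconvolution_aTrunc_jump_le : aTrunc α ⋆ₗ jump α ≤ passage α := by
  intro x
  rcases le_or_gt x 1 with hx | hx
  · rw [lconvolution_of_le (fun t => aTrunc_of_nonpos α) (fun t => jump_of_lt_one α)
      (by rwa [zero_add])]
    exact zero_le
  rw [lconvolution_eq_setLIntegral (fun t => aTrunc_of_nonpos α) (fun t => jump_of_lt_one α)]
  have hind : ∀ t, aTrunc α t * jump α (x - t) =
      (Iic 1).indicator (fun t => aE α t * jump α (x - t)) t :=
    fun t => (indicator_mul_left (i := t) (Iic 1) (aE α) fun t => jump α (x - t)).symm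
  simp only [hind]
  set m := min (x - 1) 1
  have hm : 0 ≤ m := le_min (sub_pos.2 hx).le zero_le_one
  have hm1 : m ≤ 1 := min_le_right _ _
  have hmx : m ≤ x - 1 := min_le_left _ _
  have hx1 := sub_pos.2 hx
  have hxm : 0 < x - m := by linarith
  rw [setLIntegral_indicator measurableSet_Iic, inter_comm, Ioc_inter_Iic,
    lintegral_aE_mul_jump hα0 hα1 hm hmx, passage, indicator_of_mem (mem_Ioi.2 hx)]
  have hC := (C0_pos hα0 hα1).le
  have hkey : m ^ α * (x - m) ^ (-α) ≤ (x - 1) ^ (-α) := by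
    rw [Real.rpow_neg hxm.le, Real.rpow_neg hx1.le, ← div_eq_mul_inv, div_le_iff₀ (by positivity),
      ← div_eq_inv_mul, le_div_iff₀ (by positivity), ← Real.mul_rpow hm hx1.le]
    exact Real.rpow_le_rpow (by positivity) (by nlinarith) hα0.le
  gcongr

lemma lconvolution_aTrunc_jump_add : aTrunc α ⋆ₗ jump α + smallPassage α = passage α :=
  add_tsub_cancel_of_le (lconvolution_aTrunc_jump_le hα0 hα1)

/-- The Möbius substitution `y = x / (1 + (x - 1) t)`, under which `(x - y) / x` and `y - 1` are in
the ratio `t : 1 - t`; it turns the convolution `passage * a` into a Beta integral. -/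
def passageSubst (x t : ℝ) : ℝ := x / (1 + (x - 1) * t)

omit hα0 hα1

lemma image_passageSubst (hx : 1 < x) : passageSubst x '' Ioo 0 1 = Ioo 1 x := by
  have hx1 : 0 < x - 1 := sub_pos.2 hx
  ext y
  constructor
  · rintro ⟨t, ht, rfl⟩
    have h1 := mul_pos hx1 ht.1
    have h2 := mul_pos hx1 (sub_pos.2 ht.2)
    rw [passageSubst, mem_Ioo, lt_div_iff₀ (by linarith), div_lt_iff₀ (by linarith)]
    constructor <;> nlinarith
  · intro hy
    have hy0 : 0 < y := one_pos.trans hy.1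
    have hx0 : x ≠ 0 := by linarith
    refine ⟨(x - y) / ((x - 1) * y), ⟨div_pos (sub_pos.2 hy.2) (by positivity), ?_⟩, ?_⟩
    · rw [div_lt_one (by positivity)]
      nlinarith [hy.1]
    · have hden : 1 + (x - 1) * ((x - y) / ((x - 1) * y)) = x / y := by field_simp; ring
      rw [passageSubst, hden, div_div_cancel₀ hx0]

lemma antitoneOn_passageSubst (hx : 1 < x) : AntitoneOn (passageSubst x) (Ioo 0 1) := by
  intro t ht u _ htu
  have : 0 < x - 1 := sub_pos.2 hx
  have := ht.1
  unfold passageSubst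
  gcongr

lemma hasDerivAt_passageSubst (hx : 1 < x) {t : ℝ} (ht : t ∈ Ioo (0 : ℝ) 1) :
    HasDerivAt (passageSubst x) (-(x * (x - 1) / (1 + (x - 1) * t) ^ 2)) t := by
  have hD : 0 < 1 + (x - 1) * t := add_pos one_pos (mul_pos (sub_pos.2 hx) ht.1)
  have h := (hasDerivAt_const t x).div (((hasDerivAt_id t).const_mul (x - 1)).const_add 1) hD.ne'
  convert! h using 1
  simp only [id_eq]
  ring

lemma passageSubst_integrand (hx : 1 < x) {t : ℝ} (ht : t ∈ Ioo (0 : ℝ) 1) :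
    x * (x - 1) / (1 + (x - 1) * t) ^ 2 * ((C0 α * ((passageSubst x t - 1) ^ (-α) /
      passageSubst x t)) * (C0 α * (x - passageSubst x t) ^ (α - 1))) =
      C0 α * C0 α * x ^ (α - 1) * betaKernel α (1 - α) t := by
  have hx0 : 0 < x := one_pos.trans hx
  have hx1 : 0 < x - 1 := sub_pos.2 hx
  have ht0 : 0 < t := ht.1
  have ht1 : 0 < 1 - t := sub_pos.2 ht.2
  have : 0 < 1 + (x - 1) * t := by positivity
  have h1 : x / (1 + (x - 1) * t) - 1 = (x - 1) / (1 + (x - 1) * t) * (1 - t) := by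
    field_simp; ring
  have h2 : x - x / (1 + (x - 1) * t) = (x - 1) / (1 + (x - 1) * t) * (x * t) := by
    field_simp; ring
  have hq : 0 < (x - 1) / (1 + (x - 1) * t) := by positivity
  rw [passageSubst, h1, h2, Real.mul_rpow hq.le ht1.le, Real.mul_rpow hq.le (by positivity),
    Real.mul_rpow hx0.le ht0.le, Real.rpow_neg hq.le, Real.rpow_sub_one hq.ne', betaKernel,
    sub_sub_cancel_left]
  field_simp

include hα0 hα1

lemma lconvolution_passage_aE_add : passage α ⋆ₗ aE α + aTrunc α = aE α := by
  have hC := C0_pos hα0 hα1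
  ext x
  rw [Pi.add_apply, lconvolution_eq_setLIntegral (fun t => passage_of_le_one α)
    (fun t ht => aE_of_nonpos α ht.le), sub_zero]
  rcases le_or_gt x 1 with hx | hx
  · rw [Ioc_eq_empty hx.not_gt, setLIntegral_empty, zero_add, aTrunc,
      indicator_of_mem (mem_Iic.2 hx)]
  have hintegrand : ∀ t ∈ Ioo (0 : ℝ) 1,
      ENNReal.ofReal (-(-(x * (x - 1) / (1 + (x - 1) * t) ^ 2))) *
        (passage α (passageSubst x t) * aE α (x - passageSubst x t)) =
      .ofReal (C0 α * C0 α * x ^ (α - 1)) * .ofReal (betaKernel α (1 - α) t) := fun t ht => by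
    have hy : passageSubst x t ∈ Ioo 1 x := image_passageSubst hx ▸ mem_image_of_mem _ ht
    have := sub_pos.2 hx
    have := sub_pos.2 hy.1
    have hy2 := sub_pos.2 hy.2
    have hy0 := one_pos.trans hy.1
    rw [neg_neg, passage, indicator_of_mem (mem_Ioi.2 hy.1), aE, a_of_pos α hy2,
      ← ENNReal.ofReal_mul (by positivity), ← ENNReal.ofReal_mul (by positivity),
      ← ENNReal.ofReal_mul (by positivity), passageSubst_integrand hx ht]
  rw [← setLIntegral_congr Ioo_ae_eq_Ioc, ← image_passageSubst hx,
    lintegral_image_eq_lintegral_deriv_mul_of_antitoneOn measurableSet_Ioo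
      (fun t ht => (hasDerivAt_passageSubst hx ht).hasDerivWithinAt) (antitoneOn_passageSubst hx),
    setLIntegral_congr_fun measurableSet_Ioo hintegrand,
    lintegral_const_mul _ measurable_betaKernel.ennreal_ofReal,
    lintegral_betaKernel hα0 (sub_pos.2 hα1), ← ENNReal.ofReal_mul (by positivity),
    add_sub_cancel, Real.Gamma_one, div_one, aTrunc, indicator_of_notMem (notMem_Iic.2 hx),
    add_zero, aE, a_of_pos α (one_pos.trans hx)]
  congr 1
  have hΓ : C0 α * (Real.Gamma α * Real.Gamma (1 - α)) = 1 := by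
    rw [C0_eq, one_div_mul_cancel (by simpa [C0_eq, and_comm] using hC.ne')]
  linear_combination (C0 α * x ^ (α - 1)) * hΓ

lemma aE_eq_aTrunc_add : aE α = aTrunc α + aTrunc α ⋆ₗ bE α + aE α ⋆ₗ smallPassage α := by
  have hT := measurable_aTrunc α
  have hJ := measurable_jump α
  have hA := measurable_aE α
  calc aE α = passage α ⋆ₗ aE α + aTrunc α := (lconvolution_passage_aE_add hα0 hα1).symm
    _ = (aTrunc α ⋆ₗ jump α) ⋆ₗ aE α + smallPassage α ⋆ₗ aE α + aTrunc α := by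
      rw [← add_lconvolution (by fun_prop) hA, lconvolution_aTrunc_jump_add hα0 hα1]
    _ = _ := by
      rw [← lconvolution_assoc hT hJ hA, lconvolution_comm (f := jump α),
        lconvolution_aE_jump hα0 hα1, lconvolution_comm (f := smallPassage α)]
      abel

end Subordinator

section Density

variable (α : ℝ) {x : ℝ}

/-- The renewal density `aTrunc + aTrunc * smallPassage + ⋯`. -/
def densityE : ℝ → ℝ≥0∞ := renewalSum (aTrunc α) (smallPassage α)

/-- The density of the Darling–Mandelbrot law. -/
def density (x : ℝ) : ℝ := (densityE α x).toReal

@[fun_prop]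
lemma measurable_densityE : Measurable (densityE α) :=
  measurable_renewalSum (measurable_aTrunc α) (measurable_smallPassage α)

lemma densityE_of_nonpos (hx : x ≤ 0) : densityE α x = 0 :=
  ENNReal.tsum_eq_zero.2 fun n => lconvIter_of_le (fun _ => aTrunc_of_nonpos α)
    (fun _ => smallPassage_of_le_one α) n (hx.trans n.cast_nonneg)

lemma density_of_nonpos (hx : x ≤ 0) : density α x = 0 := by
  rw [density, densityE_of_nonpos α hx, ENNReal.toReal_zero]

variable {α} (hα0 : 0 < α) (hα1 : α < 1)
include hα0 hα1

lemma densityE_add_lconvolution : densityE α + densityE α ⋆ₗ bE α = aE α :=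
  renewalSum_add_lconvolution (measurable_aTrunc α) (measurable_bE α) (measurable_smallPassage α)
    (aE_eq_aTrunc_add hα0 hα1) (fun _ => aE_of_nonpos α) fun _ => smallPassage_of_le_one α

lemma densityE_ne_top (x : ℝ) : densityE α x ≠ ∞ := by
  refine ne_top_of_le_ne_top (b := aE α x) ENNReal.ofReal_ne_top ?_
  rw [← densityE_add_lconvolution hα0 hα1]
  exact le_self_add

lemma ofReal_density (x : ℝ) : ENNReal.ofReal (density α x) = densityE α x :=
  ENNReal.ofReal_toReal (densityE_ne_top hα0 hα1 x)

lemma a_nonneg (x : ℝ) : 0 ≤ a α x :=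
  indicator_nonneg (fun _ hx => mul_nonneg (C0_pos hα0 hα1).le (Real.rpow_nonneg (le_of_lt hx) _)) x

lemma b_nonpos (x : ℝ) : b α x ≤ 0 := by
  refine indicator_nonpos (fun x hx => ?_) x
  have hC := (C0_pos hα0 hα1).le
  have hx0 : 0 ≤ x - 1 := sub_nonneg.2 (le_of_lt hx)
  have hx1 : 0 < x := one_pos.trans hx
  rw [neg_mul, neg_nonpos]
  positivity

lemma toReal_lconvolution_densityE_bE (x : ℝ) :
    ((densityE α ⋆ₗ bE α) x).toReal = -∫ t, density α t * b α (x - t) := by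
  have hnonneg : ∀ t, 0 ≤ -(density α t * b α (x - t)) := fun t => by
    rw [← mul_neg]
    exact mul_nonneg ENNReal.toReal_nonneg (neg_nonneg.2 (b_nonpos hα0 hα1 _))
  have hmeas : Measurable fun t => -(density α t * b α (x - t)) :=
    ((measurable_densityE α).ennreal_toReal.mul ((measurable_b α).comp (by fun_prop))).neg
  rw [← integral_neg, integral_eq_lintegral_of_nonneg_ae (.of_forall hnonneg)
    hmeas.aestronglyMeasurable, lconvolution_def]
  congr 1
  refine lintegral_congr fun t => ?_
  rw [← mul_neg, ENNReal.ofReal_mul (show 0 ≤ density α t from ENNReal.toReal_nonneg),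
    ofReal_density hα0 hα1, bE, neg_add_eq_sub]

lemma density_eq (x : ℝ) : density α x = a α x + ∫ t, density α t * b α (x - t) := by
  have h := congrFun (densityE_add_lconvolution hα0 hα1) x
  have htop : (densityE α ⋆ₗ bE α) x ≠ ∞ :=
    ne_top_of_le_ne_top ENNReal.ofReal_ne_top (le_add_self.trans_eq h)
  have h' := congrArg ENNReal.toReal h
  rw [Pi.add_apply, ENNReal.toReal_add (densityE_ne_top hα0 hα1 x) htop,
    toReal_lconvolution_densityE_bE hα0 hα1, aE, ENNReal.toReal_ofReal (a_nonneg hα0 hα1 x)] at h'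
  rw [density]
  linarith

lemma density_eq_sum_gConv (n : ℕ) (hx : x ≤ n) :
    density α x = ∑ k ∈ Finset.range n, gConv α k x := by
  induction n generalizing x with
  | zero => simpa using density_of_nonpos α (by simpa using hx)
  | succ n ih =>
    have h : ∀ t, density α t * b α (x - t) =
        ∑ k ∈ Finset.range n, gConv α k t * b α (x - t) := fun t => by
      rcases le_or_gt t n with ht | ht
      · rw [ih ht, Finset.sum_mul]
      · simp [b_of_le_one α (show x - t ≤ 1 by push_cast at hx; linarith)]
    have hint : ∀ k, Integrable fun t => gConv α k t * b α (x - t) :=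
      fun k => convolutionExists_gConv_b hα0 k x
    rw [density_eq hα0 hα1, Finset.sum_range_succ', add_comm]
    simp only [h, gConv_succ_apply]
    rw [integral_finsetSum _ fun k _ => hint k]
    rfl

lemma hasSum_gConv (x : ℝ) : HasSum (fun k => gConv α k x) (density α x) := by
  obtain ⟨n, hn⟩ := exists_nat_ge x
  rw [density_eq_sum_gConv hα0 hα1 n hn]
  refine hasSum_sum_of_ne_finset_zero fun k hk => gConv_of_le α k (hn.trans ?_)
  exact_mod_cast (by simpa using hk : n ≤ k)

lemma continuousOn_density : ContinuousOn (density α) (Ioi 0) := by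
  intro x hx
  obtain ⟨n, hn⟩ := exists_nat_gt x
  have hsum : ContinuousOn (fun x => ∑ k ∈ Finset.range n, gConv α k x) (Ioi 0) :=
    continuousOn_finsetSum _ fun k _ => continuousOn_gConv hα0 k
  refine ((hsum.continuousAt (isOpen_Ioi.mem_nhds hx)).congr ?_).continuousWithinAt
  filter_upwards [isOpen_Iio.mem_nhds hn] with z hz
    using (density_eq_sum_gConv hα0 hα1 n hz.le).symm

end Density

section LaplaceExponent

/-- The entire function `e^(-z) + z ∫_0^1 x^(-α) e^(-zx) dx`, which turns out to be the reciprocal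
of the Laplace transform of the Darling–Mandelbrot law. -/
def laplaceRecip (α : ℝ) (z : ℂ) : ℂ :=
  Complex.exp (-z) + z * ∫ x in Icc (0 : ℝ) 1, x ^ (-α) • Complex.exp (-z * x)

lemma hasSum_integral_smul_exp {w : ℝ → ℝ} (hw : IntegrableOn w (Icc 0 1)) (z : ℂ) :
    HasSum (fun n : ℕ => (∫ x in Icc (0 : ℝ) 1, w x * x ^ n : ℝ) * (z ^ n / n.factorial))
      (∫ x in Icc (0 : ℝ) 1, w x • Complex.exp (z * x)) := by
  have hterm : ∀ n : ℕ, ∫ x in Icc (0 : ℝ) 1, w x • ((z * x) ^ n / n.factorial : ℂ) =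
      (∫ x in Icc (0 : ℝ) 1, w x * x ^ n : ℝ) * (z ^ n / n.factorial) := fun n => by
    rw [← integral_complex_ofReal, ← integral_mul_const]
    congr 1 with x
    rw [Complex.real_smul]
    push_cast
    ring
  simp only [← hterm]
  refine hasSum_integral_of_dominated_convergence
    (fun n x => ‖w x‖ * (‖z‖ ^ n / n.factorial)) (fun n => ?_) (fun n => ?_) ?_ ?_ ?_
  · exact (hw.smul_continuousOn (by fun_prop) isCompact_Icc).aestronglyMeasurable
  · refine (ae_restrict_iff' measurableSet_Icc).2 (.of_forall fun x hx => ?_)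
    rw [norm_smul, norm_div, norm_pow, norm_mul, Complex.norm_real, Complex.norm_natCast,
      Real.norm_of_nonneg hx.1]
    have := hx.1
    gcongr
    exact mul_le_of_le_one_right (norm_nonneg z) hx.2
  · exact .of_forall fun x => (Real.summable_pow_div_factorial ‖z‖).mul_left _
  · simp only [tsum_mul_left]
    exact hw.norm.mul_const _
  · refine .of_forall fun x => HasSum.const_smul _ ?_
    rw [Complex.exp_eq_exp_ℂ]
    exact NormedSpace.expSeries_div_hasSum_exp _

variable {α : ℝ} (hα1 : α < 1)
include hα1

lemma integrableOn_rpow_neg : IntegrableOn (fun x : ℝ => x ^ (-α)) (Icc 0 1) :=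
  integrableOn_Icc_iff_integrableOn_Ioo (by simp) (by simp) |>.2 <|
    (intervalIntegral.integrableOn_Ioo_rpow_iff one_pos).2 (by linarith)

lemma integral_rpow_neg_mul_pow (n : ℕ) :
    ∫ x in Icc (0 : ℝ) 1, x ^ (-α) * x ^ n = 1 / (n + 1 - α) := by
  have h : ∀ x ∈ Ioc (0 : ℝ) 1, x ^ (-α) * x ^ n = x ^ (n - α) := fun x hx => by
    rw [← Real.rpow_natCast, ← Real.rpow_add hx.1, neg_add_eq_sub]
  have hn : -1 < n - α := by linarith [n.cast_nonneg (α := ℝ)]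
  rw [integral_Icc_eq_integral_Ioc, setIntegral_congr_fun measurableSet_Ioc h,
    ← intervalIntegral.integral_of_le zero_le_one, integral_rpow (.inl hn), Real.one_rpow,
    Real.zero_rpow (by linarith), sub_zero, sub_add_eq_add_sub]

lemma differentiable_laplaceRecip : Differentiable ℂ (laplaceRecip α) := by
  have h := differentiableOn_integral_smul (F := fun (z : ℂ) (x : ℝ) => Complex.exp (-z * x))
    (integrableOn_rpow_neg hα1) isCompact_Icc isOpen_univ (by fun_prop) (fun x _ => by fun_prop)
  exact (by fun_prop : Differentiable ℂ fun z => Complex.exp (-z)).add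
    (differentiable_id.mul (differentiableOn_univ.1 h))

lemma phi_eq (s : ℝ) : phi α s = (laplaceRecip α (-(Complex.I * s)))⁻¹ := by
  set w : ℂ := Complex.I * s
  have hexp : HasSum (fun n : ℕ => w ^ (n + 1) / (n + 1).factorial) (Complex.exp w - 1) := by
    have h := NormedSpace.expSeries_div_hasSum_exp w
    rw [← Complex.exp_eq_exp_ℂ, ← hasSum_nat_add_iff' 1] at h
    simpa using h
  have hint := (hasSum_integral_smul_exp (integrableOn_rpow_neg hα1) w).mul_left w
  have hterm : ∀ n : ℕ,
      w * ((∫ x in Icc (0 : ℝ) 1, x ^ (-α) * x ^ n : ℝ) * (w ^ n / n.factorial)) -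
        w ^ (n + 1) / (n + 1).factorial =
      α / ((n + 1 : ℕ) - α) * (w ^ (n + 1) / (n + 1).factorial) := fun n => by
    have h1 : (n + 1 - α : ℂ) ≠ 0 := by
      exact_mod_cast (by linarith [n.cast_nonneg (α := ℝ)] : (0 : ℝ) < n + 1 - α).ne'
    have h2 : (n + 1 : ℂ) ≠ 0 := by exact_mod_cast n.succ_ne_zero
    have h3 : (n.factorial : ℂ) ≠ 0 := by exact_mod_cast n.factorial_ne_zero
    rw [integral_rpow_neg_mul_pow hα1, Nat.factorial_succ]
    push_cast
    field_simp
    ring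
  have hsum := hint.sub hexp
  simp only [hterm] at hsum
  rw [phi, hsum.tsum_eq, laplaceRecip, neg_neg]
  congr 1
  ring

end LaplaceExponent

section BoundaryValues

open ProbabilityTheory

variable {μ : Measure ℝ} [IsFiniteMeasure μ] (hμ : ∀ᵐ x ∂μ, 0 ≤ x)
include hμ

lemma integrable_exp_mul_of_nonpos {r : ℝ} (hr : r ≤ 0) :
    Integrable (fun x => Real.exp (r * x)) μ := by
  refine (integrable_const (1 : ℝ)).mono' (by fun_prop) ?_
  filter_upwards [hμ] with x hx
  rw [Real.norm_of_nonneg (Real.exp_pos _).le, Real.exp_le_one_iff]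
  exact mul_nonpos_of_nonpos_of_nonneg hr hx

lemma analyticOnNhd_complexMGF_of_nonneg :
    AnalyticOnNhd ℂ (complexMGF id μ) {z | z.re < 0} := by
  have hsub : Iio 0 ⊆ interior (integrableExpSet id μ) :=
    interior_maximal (fun r hr => integrable_exp_mul_of_nonpos hμ (le_of_lt hr)) isOpen_Iio
  exact analyticOnNhd_complexMGF.mono fun z hz => hsub hz

lemma continuousOn_complexMGF_of_nonneg : ContinuousOn (complexMGF id μ) {z | z.re ≤ 0} := by
  refine continuousOn_of_dominated (bound := fun _ => 1) (fun z _ => by fun_prop) (fun z hz => ?_)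
    (integrable_const _) (.of_forall fun x => by fun_prop)
  filter_upwards [hμ] with x hx
  rw [Complex.norm_exp, Real.exp_le_one_iff, id, Complex.re_mul_ofReal]
  exact mul_nonpos_of_nonpos_of_nonneg hz hx

lemma mul_charFun_eq_one {L : ℂ → ℂ} (hL : Differentiable ℂ L)
    (h : ∀ t : ℝ, 0 < t → L t * mgf id μ (-t) = 1) (s : ℝ) :
    L (-(Complex.I * s)) * charFun μ s = 1 := by
  have hopen : EqOn (fun z => L (-z) * complexMGF id μ z) 1 {z | z.re < 0} := by
    refine AnalyticOnNhd.eqOn_of_preconnected_of_frequently_eq (z₀ := -1)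
      (.mul (fun z _ => (hL.comp differentiable_neg).analyticAt z)
        (analyticOnNhd_complexMGF_of_nonneg hμ)) (fun z _ => analyticAt_const)
      (convex_halfSpace_re_lt 0).isPreconnected (by simp) ?_
    have htend : Tendsto ((↑) : ℝ → ℂ) (𝓝[≠] (-1)) (𝓝[≠] ((-1 : ℝ) : ℂ)) :=
      Complex.continuous_ofReal.continuousWithinAt.tendsto_nhdsWithin fun t ht =>
        Complex.ofReal_injective.ne ht
    rw [Complex.ofReal_neg, Complex.ofReal_one] at htend
    refine htend.frequently (Eventually.frequently ?_)
    filter_upwards [nhdsWithin_le_nhds (Iio_mem_nhds (by norm_num : (-1 : ℝ) < 0))] with t ht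
    simpa [complexMGF_ofReal] using h (-t) (neg_pos.2 ht)
  have hclosed := hopen.of_subset_closure
    ((hL.continuous.comp continuous_neg).continuousOn.mul (continuousOn_complexMGF_of_nonneg hμ))
    continuousOn_const (fun z (hz : z.re < 0) => hz.le) (Complex.closure_setOfPred_re_lt 0).ge
  have hs : (s * Complex.I).re ≤ 0 := by simp
  rw [← complexMGF_id_mul_I, mul_comm Complex.I]
  exact hclosed hs

end BoundaryValues

section Laplace

/-- The Laplace transform at `t` of the density `f`. -/
def laplace (f : ℝ → ℝ≥0∞) (t : ℝ) : ℝ≥0∞ := ∫⁻ x, f x * .ofReal (Real.exp (-t * x))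

lemma laplace_add {f g : ℝ → ℝ≥0∞} (hf : Measurable f) (t : ℝ) :
    laplace (f + g) t = laplace f t + laplace g t := by
  simp only [laplace, Pi.add_apply, add_mul]
  exact lintegral_add_left (by fun_prop) _

lemma laplace_lconvolution {f g : ℝ → ℝ≥0∞} (hf : Measurable f) (hg : Measurable g) (t : ℝ) :
    laplace (f ⋆ₗ g) t = laplace f t * laplace g t := by
  have hsplit : ∀ x y, f y * g (-y + x) * ENNReal.ofReal (Real.exp (-t * x)) =
      f y * .ofReal (Real.exp (-t * y)) * (g (-y + x) * .ofReal (Real.exp (-t * (-y + x)))) := by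
    intro x y
    rw [mul_mul_mul_comm, ← ENNReal.ofReal_mul (Real.exp_pos _).le, ← Real.exp_add]
    ring_nf
  simp only [laplace, lconvolution_def]
  simp only [← lintegral_mul_const' _ _ ENNReal.ofReal_ne_top, hsplit]
  rw [lintegral_lintegral_swap (by fun_prop), ← lintegral_mul_const _ (by fun_prop)]
  refine lintegral_congr fun y => ?_
  rw [lintegral_const_mul _ (by fun_prop),
    lintegral_add_left_eq_self (fun x => g x * .ofReal (Real.exp (-t * x)))]

lemma laplace_indicator_ofReal {s : Set ℝ} (hs : MeasurableSet s) {f : ℝ → ℝ}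
    (hf : ∀ x ∈ s, 0 ≤ f x) {t : ℝ} (hint : IntegrableOn (fun x => f x * Real.exp (-t * x)) s) :
    laplace (s.indicator fun x => .ofReal (f x)) t =
      .ofReal (∫ x in s, f x * Real.exp (-t * x)) := by
  rw [ofReal_integral_eq_lintegral_ofReal hint ((ae_restrict_iff' hs).2 (.of_forall fun x hx =>
      mul_nonneg (hf x hx) (Real.exp_pos _).le)), laplace, ← lintegral_indicator hs]
  refine lintegral_congr fun x => ?_
  by_cases hx : x ∈ s
  · rw [indicator_of_mem hx, indicator_of_mem hx, ENNReal.ofReal_mul (hf x hx)]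
  · rw [indicator_of_notMem hx, indicator_of_notMem hx, zero_mul]

lemma toReal_laplace {f : ℝ → ℝ≥0∞} (hf : Measurable f) (t : ℝ) :
    (laplace f t).toReal = ProbabilityTheory.mgf id (volume.withDensity f) (-t) := by
  rw [ProbabilityTheory.mgf, integral_eq_lintegral_of_nonneg_ae
    (.of_forall fun x => (Real.exp_pos _).le) (by fun_prop),
    lintegral_withDensity_eq_lintegral_mul _ hf (by fun_prop)]
  rfl

lemma integrableOn_rpow_mul_exp {c t : ℝ} (hc : 0 < c) (ht : 0 < t) :
    IntegrableOn (fun x : ℝ => x ^ (c - 1) * Real.exp (-t * x)) (Ioi 0) := by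
  have h := integrableOn_rpow_mul_exp_neg_mul_rpow (s := c - 1) (by linarith) one_pos ht
  simpa only [Real.rpow_one] using h

lemma integral_rpow_mul_exp {c t : ℝ} (hc : 0 < c) (ht : 0 < t) :
    ∫ x in Ioi (0 : ℝ), x ^ (c - 1) * Real.exp (-t * x) = t ^ (-c) * Real.Gamma c := by
  simp only [neg_mul]
  rw [Real.integral_rpow_mul_exp_neg_mul_Ioi hc ht, one_div, Real.inv_rpow ht.le,
    Real.rpow_neg ht.le]

lemma integral_rpow_neg_mul_exp_nonneg (α t : ℝ) :
    0 ≤ ∫ x in Icc (0 : ℝ) 1, x ^ (-α) * Real.exp (-t * x) :=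
  setIntegral_nonneg measurableSet_Icc fun _ hx =>
    mul_nonneg (Real.rpow_nonneg hx.1 _) (Real.exp_pos _).le

variable {α : ℝ} (hα0 : 0 < α) (hα1 : α < 1) {t : ℝ} (ht : 0 < t)
include hα0 ht

lemma integral_Ioi_add_rpow_mul_exp :
    IntegrableOn (fun x : ℝ => (t * x ^ (-α) + α * x ^ (-α - 1)) * Real.exp (-t * x)) (Ioi 1) ∧
      ∫ x in Ioi (1 : ℝ), (t * x ^ (-α) + α * x ^ (-α - 1)) * Real.exp (-t * x) =
        Real.exp (-t) := by
  have hderiv : ∀ x ∈ Ici (1 : ℝ), HasDerivAt (fun x : ℝ => -(x ^ (-α) * Real.exp (-t * x)))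
      ((t * x ^ (-α) + α * x ^ (-α - 1)) * Real.exp (-t * x)) x := fun x hx => by
    have hx0 : x ≠ 0 := (one_pos.trans_le hx).ne'
    have h := ((Real.hasDerivAt_rpow_const (p := -α) (.inl hx0)).mul
      ((hasDerivAt_id x).const_mul (-t)).exp).neg
    convert! h using 1
    simp only [id_eq]
    ring
  have hnonneg : ∀ x ∈ Ioi (1 : ℝ),
      0 ≤ (t * x ^ (-α) + α * x ^ (-α - 1)) * Real.exp (-t * x) := fun x hx => by
    have hx0 : 0 < x := one_pos.trans hx
    positivity
  have hlim : Tendsto (fun x : ℝ => -(x ^ (-α) * Real.exp (-t * x))) atTop (𝓝 0) := by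
    simpa using (tendsto_rpow_mul_exp_neg_mul_atTop_nhds_zero (-α) t ht).neg
  refine ⟨integrableOn_Ioi_deriv_of_nonneg' hderiv hnonneg hlim, ?_⟩
  rw [integral_Ioi_of_hasDerivAt_of_nonneg' hderiv hnonneg hlim]
  simp

lemma integrableOn_jump_mul_exp :
    IntegrableOn (fun x : ℝ => α * x ^ (-α - 1) * Real.exp (-t * x)) (Ici 1) := by
  rw [integrableOn_Ici_iff_integrableOn_Ioi]
  refine (integral_Ioi_add_rpow_mul_exp hα0 ht).1.mono' (by fun_prop) ?_
  refine (ae_restrict_iff' measurableSet_Ioi).2 (.of_forall fun x hx => ?_)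
  have hx0 : 0 < x := one_pos.trans hx
  rw [Real.norm_of_nonneg (by positivity)]
  gcongr
  exact le_add_of_nonneg_left (by positivity)

lemma laplace_jump :
    laplace (jump α) t = .ofReal (∫ x in Ioi 1, α * x ^ (-α - 1) * Real.exp (-t * x)) := by
  rw [jump, laplace_indicator_ofReal measurableSet_Ici (fun x hx => ?_)
    (integrableOn_jump_mul_exp hα0 ht), integral_Ici_eq_integral_Ioi]
  have hx0 : 0 < x := one_pos.trans_le hx
  positivity

include hα1

lemma laplace_aE : laplace (aE α) t = .ofReal (t ^ (-α) / Real.Gamma (1 - α)) := by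
  have := C0_pos hα0 hα1
  have := Real.Gamma_pos_of_pos hα0
  have haE : aE α = (Ioi 0).indicator fun x => .ofReal (C0 α * x ^ (α - 1)) := by
    ext x
    by_cases hx : x ∈ Ioi 0
    · rw [indicator_of_mem hx, aE, a_of_pos α hx]
    · rw [indicator_of_notMem hx, aE_of_nonpos α (notMem_Ioi.1 hx)]
  rw [haE, laplace_indicator_ofReal measurableSet_Ioi (fun x hx => ?_)]
  · simp only [mul_assoc]
    rw [integral_const_mul, integral_rpow_mul_exp hα0 ht, C0_eq]
    congr 1
    field_simp
  · simp only [mul_assoc]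
    exact (integrableOn_rpow_mul_exp hα0 ht).const_mul _
  · have := Real.rpow_nonneg (le_of_lt hx) (α - 1)
    positivity

lemma exp_neg_add_mul_integral :
    Real.exp (-t) + t * ∫ x in Icc (0 : ℝ) 1, x ^ (-α) * Real.exp (-t * x) =
      t ^ α * Real.Gamma (1 - α) + ∫ x in Ioi 1, α * x ^ (-α - 1) * Real.exp (-t * x) := by
  have hint := integrableOn_rpow_mul_exp (sub_pos.2 hα1) ht
  have hΓ := integral_rpow_mul_exp (sub_pos.2 hα1) ht
  rw [sub_sub_cancel_left] at hint hΓ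
  have h1 := hint.mono_set (Ioi_subset_Ioi zero_le_one)
  have hJ := (integrableOn_jump_mul_exp hα0 ht).mono_set Ioi_subset_Ici_self
  rw [← Ioc_union_Ioi_eq_Ioi zero_le_one, setIntegral_union (Ioc_disjoint_Ioi le_rfl)
    measurableSet_Ioi (hint.mono_set Ioc_subset_Ioi_self) h1] at hΓ
  have hparts := (integral_Ioi_add_rpow_mul_exp hα0 ht).2
  simp only [add_mul, mul_assoc t] at hparts
  rw [integral_add (h1.const_mul t) hJ, integral_const_mul] at hparts
  have hpow : t * t ^ (-(1 - α)) = t ^ α := by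
    rw [← Real.rpow_one_add' ht.le (by linarith)]
    ring_nf
  rw [integral_Icc_eq_integral_Ioc]
  linear_combination t * hΓ - hparts + Real.Gamma (1 - α) * hpow

lemma laplace_densityE_mul : laplace (densityE α) t *
    .ofReal (Real.exp (-t) + t * ∫ x in Icc (0 : ℝ) 1, x ^ (-α) * Real.exp (-t * x)) = 1 := by
  have hG := measurable_densityE α
  have hA := measurable_aE α
  have hJ := measurable_jump α
  have := Real.Gamma_pos_of_pos (sub_pos.2 hα1)
  have := Real.rpow_pos_of_pos ht α
  set c := ENNReal.ofReal (t ^ α * Real.Gamma (1 - α)) with hc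
  have hAc : laplace (aE α) t * c = 1 := by
    rw [laplace_aE hα0 hα1 ht, hc, ← ENNReal.ofReal_mul (by positivity), Real.rpow_neg ht.le,
      ← ENNReal.ofReal_one]
    congr 1
    field_simp
  have hrenewal : laplace (densityE α) t +
      laplace (densityE α) t * (laplace (aE α) t * laplace (jump α) t) = laplace (aE α) t := by
    rw [← laplace_lconvolution hA hJ, lconvolution_aE_jump hα0 hα1,
      ← laplace_lconvolution hG (measurable_bE α), ← laplace_add hG,
      densityE_add_lconvolution hα0 hα1]
  have hJ0 : 0 ≤ ∫ x in Ioi 1, α * x ^ (-α - 1) * Real.exp (-t * x) :=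
    setIntegral_nonneg measurableSet_Ioi fun x hx => by
      have hx0 : 0 < x := one_pos.trans hx
      positivity
  rw [exp_neg_add_mul_integral hα0 hα1 ht, ENNReal.ofReal_add (by positivity) hJ0,
    ← laplace_jump hα0 ht, ← hc]
  calc laplace (densityE α) t * (c + laplace (jump α) t)
    _ = laplace (densityE α) t * (c + laplace (aE α) t * c * laplace (jump α) t) := by
      rw [hAc, one_mul]
    _ = (laplace (densityE α) t +
        laplace (densityE α) t * (laplace (aE α) t * laplace (jump α) t)) * c := by ring
    _ = 1 := by rw [hrenewal, hAc]

end Laplace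

section Law

lemma lintegral_le_of_laplace_le {f : ℝ → ℝ≥0∞} (hf : Measurable f) {M : ℝ≥0∞}
    (h : ∀ t ∈ Ioc (0 : ℝ) 1, laplace f t ≤ M) : ∫⁻ x, f x ≤ M := by
  have hlim : ∀ x, Tendsto (fun n : ℕ => f x * .ofReal (Real.exp (-(1 / (n + 1 : ℝ)) * x))) atTop
      (𝓝 (f x)) := fun x => by
    have hexp := ENNReal.tendsto_ofReal ((Real.continuous_exp.tendsto _).comp
      ((tendsto_one_div_add_atTop_nhds_zero_nat (𝕜 := ℝ)).neg.mul_const x))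
    simpa using ENNReal.Tendsto.const_mul (a := f x) hexp (.inl (by simp))
  calc ∫⁻ x, f x
    _ = ∫⁻ x, liminf (fun n : ℕ => f x * .ofReal (Real.exp (-(1 / (n + 1 : ℝ)) * x))) atTop :=
      lintegral_congr fun x => (hlim x).liminf_eq.symm
    _ ≤ liminf (fun n : ℕ => laplace f (1 / (n + 1))) atTop :=
      lintegral_liminf_le fun n => by fun_prop
    _ ≤ M := liminf_le_of_frequently_le' <| .of_forall fun n => h _ ⟨Nat.one_div_pos_of_nat,
      (div_le_one₀ n.cast_add_one_pos).2 (le_add_of_nonneg_left n.cast_nonneg)⟩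

/-- The Darling–Mandelbrot law, constructed from its density. -/
def law (α : ℝ) : Measure ℝ := volume.withDensity (densityE α)

variable {α : ℝ} (hα0 : 0 < α) (hα1 : α < 1)

lemma ae_nonneg_law : ∀ᵐ x ∂law α, 0 ≤ x := by
  rw [law, ae_withDensity_iff (measurable_densityE α)]
  exact .of_forall fun x hx => (not_le.1 fun h => hx (densityE_of_nonpos α h)).le

include hα0 hα1

lemma isFiniteMeasure_law : IsFiniteMeasure (law α) := by
  refine isFiniteMeasure_withDensity (ne_top_of_le_ne_top (b := .ofReal (Real.exp 1))
    ENNReal.ofReal_ne_top (lintegral_le_of_laplace_le (measurable_densityE α) fun t ht => ?_))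
  have hI := integral_rpow_neg_mul_exp_nonneg α t
  have hexp : 1 ≤ Real.exp 1 * (Real.exp (-t) + t * ∫ x in Icc (0 : ℝ) 1,
      x ^ (-α) * Real.exp (-t * x)) :=
    calc 1
      _ ≤ Real.exp 1 * Real.exp (-t) := by
        rw [← Real.exp_add]
        exact Real.one_le_exp (by linarith [ht.2])
      _ ≤ _ := by
        gcongr
        exact le_add_of_nonneg_right (mul_nonneg ht.1.le hI)
  calc laplace (densityE α) t
    _ ≤ laplace (densityE α) t * .ofReal (Real.exp 1 * (Real.exp (-t) +
        t * ∫ x in Icc (0 : ℝ) 1, x ^ (-α) * Real.exp (-t * x))) :=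
      le_mul_of_one_le_right' (ENNReal.one_le_ofReal.2 hexp)
    _ = .ofReal (Real.exp 1) := by
      rw [ENNReal.ofReal_mul (Real.exp_pos 1).le, mul_left_comm,
        laplace_densityE_mul hα0 hα1 ht.1, mul_one]

lemma laplaceRecip_mul_mgf_law {t : ℝ} (ht : 0 < t) :
    laplaceRecip α t * ProbabilityTheory.mgf id (law α) (-t) = 1 := by
  have hreal : laplaceRecip α t =
      (Real.exp (-t) + t * ∫ x in Icc (0 : ℝ) 1, x ^ (-α) * Real.exp (-t * x) : ℝ) := by
    rw [laplaceRecip]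
    push_cast [← integral_complex_ofReal, Complex.real_smul]
    rfl
  have hI := integral_rpow_neg_mul_exp_nonneg α t
  have h := congrArg ENNReal.toReal (laplace_densityE_mul hα0 hα1 ht)
  rw [ENNReal.toReal_mul, ENNReal.toReal_ofReal (by positivity), ENNReal.toReal_one,
    toReal_laplace (measurable_densityE α), mul_comm] at h
  rw [hreal]
  exact_mod_cast h

lemma charFun_law (s : ℝ) : charFun (law α) s = phi α s := by
  have := isFiniteMeasure_law hα0 hα1
  rw [phi_eq hα1]
  exact eq_inv_of_mul_eq_one_right (mul_charFun_eq_one ae_nonneg_law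
    (differentiable_laplaceRecip hα1) (fun t => laplaceRecip_mul_mgf_law hα0 hα1) s)

lemma isLaw_law : IsLaw α (law α) := by
  have := isFiniteMeasure_law hα0 hα1
  refine ⟨isProbabilityMeasure_iff_real.2 ?_, charFun_law hα0 hα1⟩
  have h := charFun_law hα0 hα1 0
  rw [charFun_zero] at h
  simpa [phi] using h

lemma isContDensity_density : IsContDensity (law α) (density α) := by
  refine ⟨fun x => ENNReal.toReal_nonneg, fun x => density_of_nonpos α,
    continuousOn_density hα0 hα1, ?_⟩
  simp only [ofReal_density hα0 hα1]
  rfl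

omit hα0 hα1

lemma IsLaw.eq {μ ν : Measure ℝ} (hμ : IsLaw α μ) (hν : IsLaw α ν) : μ = ν := by
  have := hμ.1
  have := hν.1
  exact Measure.ext_of_charFun (funext fun s => (hμ.2 s).trans (hν.2 s).symm)

variable {μ : Measure ℝ} {f g : ℝ → ℝ}

lemma IsContDensity.aemeasurable (hf : IsContDensity μ f) : AEMeasurable f := by
  have hind : f = (Ioi 0).indicator f := by
    refine (indicator_eq_self.2 fun x hx => ?_).symm
    exact lt_of_not_ge fun h => hx (hf.2.1 x h)
  rw [hind]
  exact (aemeasurable_indicator_iff measurableSet_Ioi).2 (hf.2.2.1.aemeasurable measurableSet_Ioi)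

lemma IsContDensity.eq (hf : IsContDensity μ f) (hg : IsContDensity μ g) : f = g := by
  have hae : f =ᵐ[volume] g := by
    have h := (withDensity_eq_iff_of_sigmaFinite hf.aemeasurable.ennreal_ofReal
      hg.aemeasurable.ennreal_ofReal).1 (hf.2.2.2.symm.trans hg.2.2.2)
    filter_upwards [h] with x hx
    exact (ENNReal.ofReal_eq_ofReal_iff (hf.1 x) (hg.1 x)).1 hx
  ext x
  rcases le_or_gt x 0 with hx | hx
  · rw [hf.2.1 x hx, hg.2.1 x hx]
  · exact Measure.eqOn_open_of_ae_eq (ae_restrict_of_ae hae) isOpen_Ioi hf.2.2.1 hg.2.2.1 hx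

end Law

end DarlingMandelbrot

end

theorem theorem2 (α : ℝ) (hα0 : 0 < α) (hα1 : α < 1) :
    (∃! μ : Measure ℝ, DarlingMandelbrot.IsLaw α μ) ∧
    (∀ μ : Measure ℝ, DarlingMandelbrot.IsLaw α μ → ∀ g : ℝ → ℝ,
      DarlingMandelbrot.IsContDensity μ g ↔
        ∀ x : ℝ, HasSum (fun k : ℕ => DarlingMandelbrot.gConv α k x) (g x)) ∧
    LocallyFinite (fun k : ℕ => Function.support (DarlingMandelbrot.gConv α k)) ∧
    ∀ k : ℕ,
      ConvolutionExists (DarlingMandelbrot.gConv α k) (DarlingMandelbrot.b α)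
        (ContinuousLinearMap.mul ℝ ℝ) volume ∧
      ContinuousOn (DarlingMandelbrot.gConv α k) (Ioi 0) ∧
      Function.support (DarlingMandelbrot.gConv α k) = Ioi (k : ℝ) ∧
      AnalyticOnNhd ℝ (DarlingMandelbrot.gConv α k) (Ioi (k : ℝ)) ∧
      ∀ f : ℝ → ℝ,
        f = DarlingMandelbrot.gConv α k ↔ DarlingMandelbrot.IsSeriesFunction α k f := by
  have hlaw := DarlingMandelbrot.isLaw_law hα0 hα1
  have hdens := DarlingMandelbrot.isContDensity_density hα0 hα1
  have hsum := DarlingMandelbrot.hasSum_gConv hα0 hα1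
  refine ⟨⟨_, hlaw, fun μ hμ => hμ.eq hlaw⟩, fun μ hμ g => ?_,
    DarlingMandelbrot.locallyFinite_support_gConv hα0 hα1, fun k =>
    ⟨DarlingMandelbrot.convolutionExists_gConv_b hα0 k, DarlingMandelbrot.continuousOn_gConv hα0 k,
      DarlingMandelbrot.support_gConv hα0 hα1 k, DarlingMandelbrot.analyticOnNhd_gConv hα0 k,
      fun f => ?_⟩⟩
  · obtain rfl := hμ.eq hlaw
    refine ⟨fun hg => hg.eq hdens ▸ hsum, fun hg => ?_⟩
    have hg_eq : g = DarlingMandelbrot.density α := funext fun x => (hg x).unique (hsum x)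
    exact hg_eq ▸ hdens
  · have hseries := DarlingMandelbrot.isSeriesFunction_gConv hα0 k
    exact ⟨fun hf => hf ▸ hseries, fun hf => hf.eq hseries⟩
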